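/- Setting. Let $\Omega$ be a set, let $\mathcal S_i$ ($i\in\Omega$) be commensurable submonoids of $\mathbb R_+=[0,\infty)$ (any finitely many elements of $\mathcal S_i$ are nonnegative integer multiples of one element of $\mathcal S_i$), and let $\mathcal S$ be the semigroup of finitely supported functions $s$ on $\Omega$ with $s(i)\in\mathcal S_i$. For $s\in\mathcal S-\mathcal S$ (the subgroup of $\mathbb R^\Omega$ generated by $\mathcal S$) put $s_+=\max\{0,s\}$ pointwise and $s_-=s_+-s$; both lie in $\mathcal S$. Let $A$ be a $C^*$-algebra, not necessarily unital, and let $X=\{X(s)\}_{s\in\mathcal S}$ be a product system of Hilbert $C^*$-correspondences over $A$ (so $X(0)=A$, and $X(s)\otimes_A X(t)\cong X(s+t)$ through the associative multiplication for $s,t\neq0$). A representation of $X$ on a Hilbert space $H$ is a family $T=\{T_s\}$ of completely contractive linear maps $T_s:X(s)\to B(H)$ such that $\sigma:=T_0:A\to B(H)$ is a $*$-homomorphism, $T_s(xa)=T_s(x)\sigma(a)$, $T_s(ax)=\sigma(a)T_s(x)$ and $T_{s+t}(xy)=T_s(x)T_t(y)$. It is isometric if $T_s(x)^*T_s(y)=\sigma(\langle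 x,y\rangle)$ for all $s$ and all $x,y\in X(s)$. Nondegeneracy of $\sigma$, i.e. $\overline{\operatorname{span}}\,\sigma(A)H=H$, is not part of this definition. Let $X(s)\otimes_\sigma H$ be the Hausdorff completion of the algebraic tensor product for $\langle x\otimes h,y\otimes g\rangle=\langle h,\sigma(\langle x,y\rangle)g\rangle$, and let $\tilde T_s:X(s)\otimes_\sigma H\to H$ be the contraction $\tilde T_s(x\otimes h)=T_s(x)h$. The contraction semigroup $\hat T=\{\hat T_s\}_{s\in\mathcal S}$ associated with $(\sigma,T)$ acts on $$\mathcal H=H\oplus\bigoplus_{0\ne s\in\mathcal S}X(s)\otimes_\sigma H .$$ Write $\delta_s\cdot\xi$ for the vector $\xi$ placed in the summand indexed by $s$ (the summand $H$ has index $0$). Then $\hat T_0=I$ and, for $s\ne0$: $\hat T_s(\delta_t\cdot\xi)=0$ if $t\not\ge s$; $\hat T_s(\delta_s\cdot\xi)=\delta_0\cdot\tilde T_s\xi$; and if $t>s$, then $\hat T_s(\delta_t\cdot(xy\otimes h))=\delta_{t-s}\cdot(x\otimes T_s(y)h)$ for $x\in X(t-s)$, $y\in X(s)$, $h\in H$.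 A regular isometric dilation of $\hat T$ is a semigroup $\hat V=\{\hat V_s\}_{s\in\mathcal S}$ of isometries on a Hilbert space $\mathcal K\supseteq\mathcal H$ with $P_{\mathcal H}\hat V_{s_-}^*\hat V_{s_+}|_{\mathcal H}=\hat T_{s_-}^*\hat T_{s_+}$ for all $s\in\mathcal S-\mathcal S$. Proposition. Let $(\sigma,T)$ be a representation of $X$ on a Hilbert space $H$, and assume that $\hat T$ has a regular isometric dilation. Then there exist a Hilbert space $K\supseteq H$ and an isometric representation $V$ of $X$ on $K$ such that 1. $P_H$ commutes with $V_0(A)$, and $V_0(a)P_H=\sigma(a)P_H$ for all $a\in A$; 2. $P_{X(s_-)\otimes H}\,\tilde V_{s_-}^*\tilde V_{s_+}|_{X(s_+)\otimes H}=\tilde T_{s_-}^*\tilde T_{s_+}$ for all $s\in\mathcal S-\mathcal S$, where $X(t)\otimes_\sigma H$ is regarded as a closed subspace of $X(t)\otimes_{V_0}K$ and $P_{X(t)\otimes H}$ is the orthogonal projection onto it; 3. $K$ is the closed linear span of $H\cup\{V_s(x)h: s\in\mathcal S,\ x\in X(s),\ h\in H\}$, and if $\sigma$ is nondegenerate, then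 already $K=\bigvee\{V_s(x)h: s\in\mathcal S,\ x\in X(s),\ h\in H\}$; 4. $P_HV_s(x)|_{K\ominus H}=0$ for all $s\in\mathcal S$, $x\in X(s)$. Moreover, if $\sigma$ is nondegenerate and $X$ is essential (that is, $AX(s)$ spans a dense subspace of $X(s)$ for all $s\in\mathcal S$), then $V_0$ is nondegenerate. -/

import Mathlib

open scoped TensorProduct InnerProductSpace InnerProduct NNReal

set_option linter.unusedSectionVars false

universe uA uE uH uK uX uΩ

noncomputable section

namespace ProductSystemDilation

section CStarFacts

variable {B : Type*} [NonUnitalCStarAlgebra B] [PartialOrder B] [StarOrderedRing B]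

lemma exists_neg_witness (R : B) (hsa : IsSelfAdjoint R) :
    ∃ b c : B, star b * R * b = - (star c * c) ∧ (c = 0 → 0 ≤ R) := by
  set b := R⁻ with hb
  have hb0 : 0 ≤ b := CFC.negPart_nonneg R
  have hbs : IsSelfAdjoint b := .of_nonneg hb0
  have h1 : star b * R * b = - (b * b * b) := by
    rw [hbs.star_eq]
    have : R = R⁺ - R⁻ := (CFC.posPart_sub_negPart R hsa).symm
    have h0 : R⁻ * R⁺ = 0 := CFC.negPart_mul_posPart R
    calc b * R * b = (R⁻ * (R⁺ - R⁻)) * R⁻ := by rw [← this]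
      _ = _ := by rw [mul_sub, h0]; simp [hb]
  set r := CFC.sqrt b with hr
  have hrr : r * r = b := CFC.sqrt_mul_sqrt_self b
  have hrs : IsSelfAdjoint r := .of_nonneg (CFC.sqrt_nonneg b)
  have h2 : star (r * b) * (r * b) = b * b * b := by
    rw [star_mul, hrs.star_eq, hbs.star_eq]
    calc b * r * (r * b) = b * (r * r) * b := by simp only [mul_assoc]
      _ = _ := by rw [hrr]
  refine ⟨b, r * b, by rw [h1, h2], fun h3 => ?_⟩
  have h4 : b = 0 := by
    have hb2 : b * b = 0 := by
      calc b * b = r * (r * b) := by rw [← mul_assoc, hrr]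
        _ = 0 := by rw [h3, mul_zero]
    have := CStarRing.star_mul_self_eq_zero_iff b
    rw [hbs.star_eq] at this
    exact this.1 hb2
  exact (CFC.negPart_eq_zero_iff R hsa).1 h4

lemma exists_sqrt_approx (R : B) (hR : 0 ≤ R) :
    ∃ d : B, star d * d = R ∧ ∀ ε : ℝ, 0 < ε → ∃ c : B, ‖star c * R * c‖ ≤ 1 ∧
      ‖R - R * (c * d) - star (c * d) * R + star (c * d) * R * (c * d)‖ ≤ ε := by
  have hsa : IsSelfAdjoint R := .of_nonneg hR
  have hq : ∀ x ∈ quasispectrum ℝ R, 0 ≤ x := fun x hx => quasispectrum_nonneg_of_nonneg R hR x hx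
  have hd : IsSelfAdjoint (cfcₙ Real.sqrt R) := cfcₙ_predicate _ _
  have hR1 : cfcₙ (fun x : ℝ => x) R = R := cfcₙ_id' ℝ R
  refine ⟨cfcₙ Real.sqrt R, ?_, fun ε hε => ?_⟩
  · rw [hd.star_eq, ← cfcₙ_mul Real.sqrt Real.sqrt R]
    conv_rhs => rw [← hR1]
    exact cfcₙ_congr fun x hx => Real.mul_self_sqrt (hq x hx)
  · set g : ℝ → ℝ := fun t => Real.sqrt t / (t + ε) with hg
    set e : ℝ → ℝ := fun t => t / (t + ε) with he
    have hpos : ∀ x ∈ quasispectrum ℝ R, x + ε ≠ 0 := fun x hx => by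
      have := hq x hx; positivity
    have hgc : ContinuousOn g (quasispectrum ℝ R) :=
      Real.continuous_sqrt.continuousOn.div (by fun_prop) hpos
    have hec : ContinuousOn e (quasispectrum ℝ R) :=
      continuousOn_id.div (by fun_prop) hpos
    have hg0 : g 0 = 0 := by simp [hg]
    have he0 : e 0 = 0 := by simp [he]
    have hcs : IsSelfAdjoint (cfcₙ g R) := cfcₙ_predicate _ _
    have hes : IsSelfAdjoint (cfcₙ e R) := cfcₙ_predicate _ _
    have hcd : cfcₙ g R * cfcₙ Real.sqrt R = cfcₙ e R := by
      rw [← cfcₙ_mul g Real.sqrt R]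
      refine cfcₙ_congr fun x hx => ?_
      simp only [hg, he]
      rw [div_mul_eq_mul_div, Real.mul_self_sqrt (hq x hx)]
    refine ⟨cfcₙ g R, ?_, ?_⟩
    · rw [hcs.star_eq]
      nth_rewrite 2 [← hR1]
      rw [← cfcₙ_mul g (fun x => x) R, ← cfcₙ_mul (fun x => g x * x) g R]
      refine norm_cfcₙ_le fun x hx => ?_
      have h0 := hq x hx
      have hs : Real.sqrt x * Real.sqrt x = x := Real.mul_self_sqrt h0
      have : g x * x * g x = (x / (x + ε)) ^ 2 := by
        simp only [hg]
        rw [div_pow, sq x, sq (x + ε)]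
        field_simp
        rw [Real.sq_sqrt h0, sq]
      rw [this, Real.norm_of_nonneg (by positivity)]
      apply pow_le_one₀ (by positivity)
      rw [div_le_one (by positivity)]; linarith
    · rw [hcd, hes.star_eq]
      have hid : ContinuousOn (fun x : ℝ => x) (quasispectrum ℝ R) := continuousOn_id
      have h1 : R * cfcₙ e R = cfcₙ (fun x => x * e x) R := by
        nth_rewrite 1 [← hR1]; rw [← cfcₙ_mul (fun x => x) e R]
      have h2 : cfcₙ e R * R = cfcₙ (fun x => e x * x) R := by
        nth_rewrite 2 [← hR1]; rw [← cfcₙ_mul e (fun x => x) R]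
      have h3 : cfcₙ e R * R * cfcₙ e R = cfcₙ (fun x => e x * x * e x) R := by
        rw [h2, ← cfcₙ_mul (fun x => e x * x) e R]
      rw [h3, h1, h2]
      nth_rewrite 1 [← hR1]
      rw [← cfcₙ_sub (fun x => x) (fun x => x * e x) R (by fun_prop) (by simp)
          (by fun_prop) (by simp),
        ← cfcₙ_sub (fun x => x - x * e x) (fun x => e x * x) R (by fun_prop) (by simp)
          (by fun_prop) (by simp),
        ← cfcₙ_add (fun x => x - x * e x - e x * x) (fun x => e x * x * e x) R
          (by fun_prop) (by simp) (by fun_prop) (by simp)]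
      refine norm_cfcₙ_le fun x hx => ?_
      have h0 := hq x hx
      have : x - x * e x - e x * x + e x * x * e x = x * ε ^ 2 / (x + ε) ^ 2 := by
        simp only [he]; field_simp; ring
      rw [this, Real.norm_of_nonneg (by positivity), div_le_iff₀ (by positivity)]
      nlinarith [mul_nonneg h0 hε.le, mul_nonneg hε.le (mul_nonneg h0 h0), pow_pos hε 3,
        mul_nonneg h0 (sq_nonneg ε)]

end CStarFacts

section Correspondences

/-- A Hilbert C⋆-correspondence over `A` (together with completeness of `E`, which is always
assumed separately): a right Hilbert `A`-module `E`, with `A`-valued inner product `ip` that is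
linear in the second variable, and a left action of `A` by adjointable operators, i.e. a
`*`-homomorphism from `A` to the adjointable operators on `E`.
(Mathlib's `CStarModule A E` is linear over a *left* action of `A`, hence this class.) -/
class Correspondence (A : Type uA) [NonUnitalCStarAlgebra A] [PartialOrder A]
    (E : Type uE) [NormedAddCommGroup E] [NormedSpace ℂ E] where
  /-- the `A`-valued inner product `⟨x, y⟩` -/
  ip : E → E → A
  /-- the right action `x ↦ x a`, written `ract x a` -/
  ract : E →ₗ[ℂ] A →ₗ[ℂ] E
  /-- the left action `x ↦ a x`, written `lact a x` -/
  lact : A →ₗ[ℂ] E →ₗ[ℂ] E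
  ip_add_right : ∀ x y z, ip x (y + z) = ip x y + ip x z
  ip_smul_right : ∀ (c : ℂ) x y, ip x (c • y) = c • ip x y
  star_ip : ∀ x y, star (ip x y) = ip y x
  ip_self_nonneg : ∀ x, 0 ≤ ip x x
  norm_sq_eq : ∀ x, ‖x‖ ^ 2 = ‖ip x x‖
  ract_mul : ∀ x a b, ract x (a * b) = ract (ract x a) b
  ip_ract_right : ∀ x y a, ip x (ract y a) = ip x y * a
  lact_mul : ∀ a b x, lact (a * b) x = lact a (lact b x)
  lact_ract : ∀ a x b, lact a (ract x b) = ract (lact a x) b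
  ip_lact_left : ∀ a x y, ip (lact a x) y = ip x (lact (star a) y)

open Correspondence

variable {A : Type uA} [NonUnitalCStarAlgebra A] [PartialOrder A]
variable {E : Type uE} [NormedAddCommGroup E] [NormedSpace ℂ E] [Correspondence A E]

lemma ip_add_left (x y z : E) : ip (A := A) (x + y) z = ip x z + ip y z := by
  rw [← star_ip, ip_add_right, star_add, star_ip, star_ip]

lemma ip_smul_left (c : ℂ) (x y : E) : ip (A := A) (c • x) y = star c • ip x y := by
  rw [← star_ip, ip_smul_right, star_smul, star_ip]

lemma ip_zero_right (x : E) : ip (A := A) x 0 = 0 := by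
  simpa using ip_smul_right (A := A) 0 x (0 : E)

lemma ip_zero_left (x : E) : ip (A := A) 0 x = 0 := by
  simpa using ip_smul_left (A := A) 0 (0 : E) x

lemma ip_sum_right {ι : Type*} (s : Finset ι) (x : E) (y : ι → E) :
    ip (A := A) x (∑ i ∈ s, y i) = ∑ i ∈ s, ip x (y i) := by
  classical
  induction s using Finset.induction_on with
  | empty => simp [ip_zero_right]
  | insert i s hi ih => simp [Finset.sum_insert hi, ip_add_right, ih]

lemma ip_sum_left {ι : Type*} (s : Finset ι) (x : ι → E) (y : E) :
    ip (A := A) (∑ i ∈ s, x i) y = ∑ i ∈ s, ip (x i) y := by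
  rw [← star_ip, ip_sum_right, star_sum]
  simp [star_ip]

lemma ip_ract_left (x y : E) (a : A) : ip (ract x a) y = star a * ip x y := by
  rw [← star_ip, ip_ract_right, star_mul, star_ip]

lemma ip_sub_left (x y z : E) : ip (A := A) (x - y) z = ip x z - ip y z := by
  have := ip_add_left (A := A) x (-y) z
  rw [← neg_one_smul ℂ y, ip_smul_left] at this
  simpa [sub_eq_add_neg] using this

lemma ip_sub_right (x y z : E) : ip (A := A) x (y - z) = ip x y - ip x z := by
  rw [← star_ip, ip_sub_left, star_sub, star_ip, star_ip]

/-- The Gram matrix `(⟨x_i, x_j⟩)` in `M_n(A)`. -/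
def gram {ι : Type} (x : ι → E) : CStarMatrix ι ι A :=
  CStarMatrix.ofMatrix (Matrix.of fun i j => ip (x i) (x j))

lemma gram_apply {ι : Type} (x : ι → E) (i j : ι) : gram (A := A) x i j = ip (x i) (x j) := rfl

lemma gram_isSelfAdjoint {ι : Type} (x : ι → E) : IsSelfAdjoint (gram (A := A) x) := by
  ext i j
  rw [CStarMatrix.star_apply, gram_apply, gram_apply, star_ip]

variable {ι : Type} [Fintype ι]

/-- `b* (⟨x_i, x_j⟩) b` is the Gram matrix of `(∑ x_i b_{ij})_j`. -/
lemma star_mul_gram_mul (x : ι → E) (b : CStarMatrix ι ι A) :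
    star b * gram x * b = gram fun j => ∑ i, ract (x i) (b i j) := by
  ext i j
  simp only [CStarMatrix.mul_apply, CStarMatrix.star_apply, gram_apply,
    ip_sum_left, ip_sum_right, ip_ract_left, ip_ract_right, Finset.sum_mul, mul_assoc]

variable [StarOrderedRing A]

lemma eq_zero_of_diag {c : CStarMatrix ι ι A}
    (h : ∀ j, (star c * c) j j ≤ 0) : c = 0 := by
  ext k j
  have h1 : (star c * c) j j = ∑ k, star (c k j) * c k j := by
    simp [CStarMatrix.mul_apply, CStarMatrix.star_apply]
  have h2 : ∑ k, star (c k j) * c k j = 0 :=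
    le_antisymm (h1 ▸ h j) (Finset.sum_nonneg fun k _ => star_mul_self_nonneg _)
  have h3 := (Finset.sum_eq_zero_iff_of_nonneg (fun k _ => star_mul_self_nonneg (c k j))).1 h2 k
    (Finset.mem_univ _)
  simpa using (CStarRing.star_mul_self_eq_zero_iff _).1 h3

lemma gram_nonneg (x : ι → E) : 0 ≤ gram (A := A) x := by
  obtain ⟨b, c, h, h'⟩ := exists_neg_witness _ (gram_isSelfAdjoint (A := A) x)
  refine h' (eq_zero_of_diag fun j => ?_)
  rw [star_mul_gram_mul] at h
  rw [← neg_neg (star c * c), ← h]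
  have := ip_self_nonneg (A := A) (∑ i, ract (x i) (b i j))
  rw [CStarMatrix.neg_apply, gram_apply]
  simpa using this

/-- The Gram matrix is of the form `d* d`, with an approximate polar decomposition `x ≈ y d`. -/
lemma exists_gram_eq (x : ι → E) :
    ∃ d : CStarMatrix ι ι A, (∀ i j, ip (x i) (x j) = ∑ k, star (d k i) * d k j) ∧
      ∀ ε : ℝ, 0 < ε → ∃ y : ι → E, ‖gram (A := A) y‖ ≤ 1 ∧
        ∀ i, ‖x i - ∑ j, ract (y j) (d j i)‖ ≤ ε := by
  obtain ⟨d, hd, H⟩ := exists_sqrt_approx _ (gram_nonneg (A := A) x)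
  refine ⟨d, fun i j => ?_, fun ε hε => ?_⟩
  · have := congrFun (congrFun hd i) j
    simp only [CStarMatrix.mul_apply, CStarMatrix.star_apply] at this
    rw [this]; rfl
  · obtain ⟨c, hc, hc'⟩ := H (ε ^ 2) (by positivity)
    refine ⟨fun j => ∑ i, ract (x i) (c i j), by rwa [← star_mul_gram_mul], fun i => ?_⟩
    have h1 : ∑ j, ract (∑ i, ract (x i) (c i j)) (d j i) = ∑ k, ract (x k) ((c * d) k i) := by
      simp only [CStarMatrix.mul_apply, map_sum, LinearMap.sum_apply, ← ract_mul]
      rw [Finset.sum_comm]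
    rw [h1]
    refine le_of_sq_le_sq ?_ hε.le
    rw [norm_sq_eq (A := A)]
    refine le_trans (le_of_eq ?_) ((CStarMatrix.norm_entry_le_norm (i := i) (j := i)).trans hc')
    congr 1
    rw [star_mul_gram_mul]
    simp only [CStarMatrix.sub_apply, CStarMatrix.add_apply, gram_apply]
    rw [CStarMatrix.mul_apply, CStarMatrix.mul_apply]
    simp only [CStarMatrix.star_apply, gram_apply, ip_sub_left, ip_sub_right, ip_sum_left,
      ip_sum_right, ip_ract_left, ip_ract_right, sub_mul, Finset.sum_sub_distrib]
    abel

end Correspondences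

section Tensor

open Correspondence

/-- The norm of the matrix space `M_n(E)`: the Hilbert module norm of a matrix over `E`, i.e.
`‖(x_{ij})‖ = ‖(∑_k ⟨x_{ki}, x_{kj}⟩)_{ij}‖^{1/2}`, the norm on the right being the C⋆-norm of
`M_n(A)`. -/
def matNorm (A : Type uA) [NonUnitalCStarAlgebra A] [PartialOrder A] [StarOrderedRing A]
    {E : Type uE} [NormedAddCommGroup E] [NormedSpace ℂ E] [Correspondence A E]
    {n : ℕ} (x : Fin n → Fin n → E) : ℝ :=
  √‖CStarMatrix.ofMatrix (Matrix.of fun i j => ∑ k, ip (A := A) (x k i) (x k j))‖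

/-- `T : E → B(H)` is completely contractive: for every `n` the entrywise application of `T` is
a contraction from `M_n(E)` to `M_n(B(H)) = B(H ⊕ ⋯ ⊕ H)`. -/
def IsCompletelyContractive (A : Type uA) [NonUnitalCStarAlgebra A] [PartialOrder A]
    [StarOrderedRing A] {E : Type uE} [NormedAddCommGroup E] [NormedSpace ℂ E]
    [Correspondence A E] {H : Type uH} [NormedAddCommGroup H] [InnerProductSpace ℂ H]
    (T : E →ₗ[ℂ] (H →L[ℂ] H)) : Prop :=
  ∀ (n : ℕ) (x : Fin n → Fin n → E) (h : Fin n → H),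
    ∑ i, ‖∑ j, T (x i j) (h j)‖ ^ 2 ≤ matNorm A x ^ 2 * ∑ j, ‖h j‖ ^ 2

variable {A : Type uA} [NonUnitalCStarAlgebra A] [PartialOrder A] [StarOrderedRing A]
variable {H : Type uH} [NormedAddCommGroup H] [InnerProductSpace ℂ H] [CompleteSpace H]
variable (σ : A →⋆ₙₐ[ℂ] (H →L[ℂ] H))
variable (E : Type uE) [NormedAddCommGroup E] [NormedSpace ℂ E] [Correspondence A E]

/-- The algebraic tensor product `E ⊗ H`, to be given the semi-inner product
`⟨x ⊗ h, y ⊗ g⟩ = ⟨h, σ(⟨x, y⟩) g⟩`. -/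
@[nolint unusedArguments]
def PreTensor (_σ : A →⋆ₙₐ[ℂ] (H →L[ℂ] H)) (E : Type uE) [NormedAddCommGroup E]
    [NormedSpace ℂ E] [Correspondence A E] : Type (max uE uH) := E ⊗[ℂ] H

instance : AddCommGroup (PreTensor σ E) := inferInstanceAs (AddCommGroup (E ⊗[ℂ] H))
instance : Module ℂ (PreTensor σ E) := inferInstanceAs (Module ℂ (E ⊗[ℂ] H))

/-- The sesquilinear form `⟨x ⊗ h, y ⊗ g⟩ = ⟨h, σ(⟨x, y⟩) g⟩` on `E ⊗ H`, conjugate linear in the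
first variable. -/
def tensorForm : E ⊗[ℂ] H →ₗ⋆[ℂ] E ⊗[ℂ] H →ₗ[ℂ] ℂ :=
  TensorProduct.lift <| LinearMap.mk₂'ₛₗ (starRingEnd ℂ) (starRingEnd ℂ)
    (fun (x : E) (h : H) => TensorProduct.lift <| LinearMap.mk₂ ℂ
      (fun (y : E) (g : H) => ⟪h, σ (ip x y) g⟫_ℂ)
      (fun y y' g => by simp [ip_add_right])
      (fun c y g => by simp [ip_smul_right])
      (fun y g g' => by simp)
      (fun c y g => by simp))
    (fun x x' h => by ext y g; simp [ip_add_left])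
    (fun c x h => by ext y g; simp [ip_smul_left])
    (fun x h h' => by ext y g; simp)
    (fun c x h => by ext y g; simp [mul_comm])

variable {E}

@[simp] lemma tensorForm_tmul (x y : E) (h g : H) :
    tensorForm σ E (x ⊗ₜ h) (y ⊗ₜ g) = ⟪h, σ (ip x y) g⟫_ℂ := by
  simp [tensorForm]

lemma exists_fin_sum {M : Type*} {N : Type*} [AddCommGroup M] [Module ℂ M] [AddCommGroup N]
    [Module ℂ N] (u : M ⊗[ℂ] N) :
    ∃ (n : ℕ) (x : Fin n → M) (h : Fin n → N), u = ∑ i, x i ⊗ₜ[ℂ] h i := by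
  obtain ⟨S, hS⟩ := TensorProduct.exists_finset u
  refine ⟨S.card, fun i => (S.equivFin.symm i).1.1, fun i => (S.equivFin.symm i).1.2, ?_⟩
  rw [hS, ← S.sum_coe_sort]
  exact (Equiv.sum_comp S.equivFin.symm fun p : S => p.1.1 ⊗ₜ[ℂ] p.1.2).symm

lemma sum_inner_eq {ι : Type} [Fintype ι] {R : ι → ι → A} {d : CStarMatrix ι ι A}
    (hd : ∀ i j, R i j = ∑ k, star (d k i) * d k j) (h : ι → H) :
    ∑ i, ∑ j, ⟪h i, σ (R i j) (h j)⟫_ℂ = ((∑ k, ‖∑ j, σ (d k j) (h j)‖ ^ 2 : ℝ) : ℂ) := by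
  have h1 : ∀ k, ((‖∑ j, σ (d k j) (h j)‖ ^ 2 : ℝ) : ℂ) =
      ∑ i, ∑ j, ⟪h i, σ (star (d k i) * d k j) (h j)⟫_ℂ := by
    intro k
    have := inner_self_eq_norm_sq_to_K (𝕜 := ℂ) (∑ j, σ (d k j) (h j))
    push_cast
    rw [← Complex.coe_algebraMap, ← this, sum_inner]
    refine Finset.sum_congr rfl fun i _ => ?_
    rw [inner_sum]
    refine Finset.sum_congr rfl fun j _ => ?_
    rw [map_mul, map_star, ContinuousLinearMap.star_eq_adjoint, mul_apply_eq_comp,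
      ContinuousLinearMap.adjoint_inner_right]
  push_cast
  simp only [← Complex.ofReal_pow, h1, hd, map_sum, sum_apply, inner_sum]
  rw [Finset.sum_comm]
  rw [Finset.sum_comm]
  symm
  rw [Finset.sum_comm]
  refine Finset.sum_congr rfl fun i _ => ?_
  rw [Finset.sum_comm]

lemma tensorForm_sum {ι : Type} [Fintype ι] (x : ι → E) (h : ι → H) {d : CStarMatrix ι ι A}
    (hd : ∀ i j, ip (x i) (x j) = ∑ k, star (d k i) * d k j) :
    tensorForm σ E (∑ i, x i ⊗ₜ h i) (∑ i, x i ⊗ₜ h i) =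
      ((∑ k, ‖∑ j, σ (d k j) (h j)‖ ^ 2 : ℝ) : ℂ) := by
  rw [← sum_inner_eq σ hd]
  simp only [map_sum, LinearMap.sum_apply, tensorForm_tmul]
  rw [Finset.sum_comm]

lemma tensorForm_conj (u v : E ⊗[ℂ] H) :
    (starRingEnd ℂ) (tensorForm σ E v u) = tensorForm σ E u v := by
  induction u with
  | zero => simp
  | add u u' hu hu' => simp [hu, hu']
  | tmul x h =>
    induction v with
    | zero => simp
    | add v v' hv hv' => simp [hv, hv']
    | tmul y g =>
      rw [tensorForm_tmul, tensorForm_tmul, inner_conj_symm, ← star_ip x y, map_star,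
        ContinuousLinearMap.star_eq_adjoint, ContinuousLinearMap.adjoint_inner_left]

lemma tensorForm_self_nonneg (u : E ⊗[ℂ] H) : 0 ≤ (tensorForm σ E u u).re := by
  obtain ⟨n, x, h, rfl⟩ := exists_fin_sum u
  obtain ⟨d, hd, -⟩ := exists_gram_eq (A := A) x
  rw [tensorForm_sum σ x h hd, Complex.ofReal_re]
  positivity

variable (E)

/-- The semi-inner product on `E ⊗ H`. -/
abbrev preTensorCore : PreInnerProductSpace.Core ℂ (PreTensor σ E) where
  inner u v := tensorForm σ E u v
  conj_inner_symm u v := tensorForm_conj σ u v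
  re_inner_nonneg u := tensorForm_self_nonneg σ u
  add_left u v w := (tensorForm σ E).map_add₂ u v w
  smul_left u v c := (tensorForm σ E).map_smulₛₗ₂ c u v

instance : SeminormedAddCommGroup (PreTensor σ E) :=
  InnerProductSpace.Core.toSeminormedAddCommGroup (c := preTensorCore σ E)
instance : InnerProductSpace ℂ (PreTensor σ E) :=
  InnerProductSpace.ofCore (preTensorCore σ E)

/-- The Hilbert space `E ⊗_σ H`: the Hausdorff completion of the algebraic tensor product. -/
abbrev InteriorTensor : Type (max uE uH) := UniformSpace.Completion (PreTensor σ E)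

/-- The canonical map from the algebraic tensor product to `E ⊗_σ H`. -/
def toInterior : E ⊗[ℂ] H →ₗ[ℂ] InteriorTensor σ E :=
  (UniformSpace.Completion.toComplL (𝕜 := ℂ) (E := PreTensor σ E)).toLinearMap

variable {E}

/-- The elementary tensor `x ⊗ h` in `E ⊗_σ H`. -/
def tmul (x : E) (h : H) : InteriorTensor σ E := toInterior σ E (x ⊗ₜ h)

lemma inner_toInterior (u v : E ⊗[ℂ] H) :
    ⟪toInterior σ E u, toInterior σ E v⟫_ℂ = tensorForm σ E u v :=
  UniformSpace.Completion.inner_coe (𝕜 := ℂ) (E := PreTensor σ E) u v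

lemma inner_tmul_tmul (x y : E) (h g : H) :
    ⟪tmul σ x h, tmul σ y g⟫_ℂ = ⟪h, σ (ip x y) g⟫_ℂ := by
  rw [tmul, tmul, inner_toInterior, tensorForm_tmul]

lemma norm_tmul_le (x : E) (h : H) : ‖tmul σ x h‖ ≤ ‖x‖ * ‖h‖ := by
  refine le_of_sq_le_sq ?_ (by positivity)
  rw [← inner_self_eq_norm_sq (𝕜 := ℂ), inner_tmul_tmul, mul_pow, norm_sq_eq (A := A)]
  refine (RCLike.re_le_norm _).trans ((norm_inner_le_norm _ _).trans ?_)
  have h1 := (σ (ip x x)).le_of_opNorm_le (NonUnitalStarAlgHom.norm_apply_le σ (ip x x)) h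
  nlinarith [norm_nonneg h]

lemma denseRange_toInterior : DenseRange (toInterior σ E) :=
  UniformSpace.Completion.denseRange_coe (α := PreTensor σ E)

lemma norm_sq_toInterior (u : E ⊗[ℂ] H) :
    ‖toInterior σ E u‖ ^ 2 = (tensorForm σ E u u).re := by
  rw [← inner_toInterior, ← inner_self_eq_norm_sq (𝕜 := ℂ)]; rfl

lemma norm_sq_toInterior_sum {ι : Type} [Fintype ι] (x : ι → E) (h : ι → H)
    {d : CStarMatrix ι ι A} (hd : ∀ i j, ip (x i) (x j) = ∑ k, star (d k i) * d k j) :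
    ‖toInterior σ E (∑ i, x i ⊗ₜ h i)‖ ^ 2 = ∑ k, ‖∑ j, σ (d k j) (h j)‖ ^ 2 := by
  rw [norm_sq_toInterior, tensorForm_sum σ x h hd, Complex.ofReal_re]

/-- On algebraic tensors, `x ⊗ h ↦ T(x) h`. -/
def preTilde (T : E →ₗ[ℂ] (H →L[ℂ] H)) : E ⊗[ℂ] H →ₗ[ℂ] H :=
  TensorProduct.lift ((ContinuousLinearMap.coeLM ℂ).comp T)

@[simp] lemma preTilde_tmul (T : E →ₗ[ℂ] (H →L[ℂ] H)) (x : E) (h : H) :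
    preTilde T (x ⊗ₜ h) = T x h := by simp [preTilde]

lemma norm_row_le {T : E →ₗ[ℂ] (H →L[ℂ] H)} (hT : IsCompletelyContractive A T)
    {n : ℕ} (y : Fin n → E) (hy : ‖gram (A := A) y‖ ≤ 1) (h : Fin n → H) :
    ‖∑ j, T (y j) (h j)‖ ^ 2 ≤ ∑ j, ‖h j‖ ^ 2 := by
  cases n with
  | zero => simp
  | succ n =>
    have := hT (n + 1) (fun i j => if i = 0 then y j else 0) h
    have h1 : matNorm A (fun i j : Fin (n + 1) => if i = 0 then y j else 0) ^ 2 ≤ 1 := by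
      rw [matNorm, Real.sq_sqrt (norm_nonneg _)]
      refine le_trans (le_of_eq ?_) hy
      congr 1
      ext i j
      rw [gram_apply]
      change ∑ k : Fin (n + 1), ip (A := A) (if k = 0 then y i else 0) (if k = 0 then y j else 0) = _
      rw [Finset.sum_eq_single 0]
      · simp
      · intro b _ hb; simp [hb, ip_zero_right]
      · simp
    have h2 : ‖∑ j, T (y j) (h j)‖ ^ 2 ≤
        ∑ i : Fin (n + 1), ‖∑ j, T (if i = 0 then y j else 0) (h j)‖ ^ 2 := by
      refine le_trans (le_of_eq ?_) (Finset.single_le_sum (f := fun i : Fin (n + 1) =>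
        ‖∑ j, T (if i = 0 then y j else 0) (h j)‖ ^ 2) (fun i _ => by positivity)
        (Finset.mem_univ 0))
      simp
    refine h2.trans (this.trans ?_)
    exact mul_le_of_le_one_left (by positivity) h1

variable {T : E →ₗ[ℂ] (H →L[ℂ] H)}

lemma norm_le_of_cc (hT : IsCompletelyContractive A T) (x : E) (h : H) :
    ‖T x h‖ ≤ ‖x‖ * ‖h‖ := by
  have := hT 1 (fun _ _ => x) (fun _ => h)
  simp only [Finset.univ_unique, Finset.sum_singleton] at this
  refine le_of_sq_le_sq (this.trans ?_) (by positivity)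
  rw [mul_pow]
  refine mul_le_mul_of_nonneg_right ?_ (by positivity)
  rw [matNorm, Real.sq_sqrt (norm_nonneg _), norm_sq_eq (A := A)]
  let e := CStarMatrix.toOneByOne (Fin 1) ℂ A
  let φ : A →⋆ₙₐ[ℂ] CStarMatrix (Fin 1) (Fin 1) A :=
    { toFun := e
      map_smul' := fun c a => map_smul e c a
      map_zero' := rfl
      map_add' := e.map_add'
      map_mul' := e.map_mul'
      map_star' := e.map_star' }
  have h1 := NonUnitalStarAlgHom.norm_apply_le φ (ip x x)
  refine le_trans (le_of_eq ?_) h1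
  congr 1
  ext i j
  change ∑ k : Fin 1, ip (A := A) x x = ip x x
  simp

/-- The contraction estimate behind `T̃`. -/
lemma norm_preTilde_le (hT : IsCompletelyContractive A T)
    (hσ : ∀ x a, T (ract x a) = T x ∘L σ a) (u : E ⊗[ℂ] H) :
    ‖preTilde T u‖ ≤ ‖toInterior σ E u‖ := by
  obtain ⟨n, x, h, rfl⟩ := exists_fin_sum u
  obtain ⟨d, hd, H'⟩ := exists_gram_eq (A := A) x
  refine le_of_forall_pos_le_add fun δ hδ => ?_
  set C : ℝ := ∑ i, ‖h i‖ with hC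
  have hC0 : 0 ≤ C := Finset.sum_nonneg fun _ _ => norm_nonneg _
  obtain ⟨y, hy, hxy⟩ := H' (δ / (C + 1)) (by positivity)
  have h1 : preTilde T (∑ i, x i ⊗ₜ h i) =
      ∑ j, T (y j) (∑ i, σ (d j i) (h i)) +
        ∑ i, T (x i - ∑ j, ract (y j) (d j i)) (h i) := by
    simp only [map_sum, preTilde_tmul, map_sub, sub_apply,
      sum_apply, hσ, ContinuousLinearMap.comp_apply, Finset.sum_sub_distrib]
    rw [Finset.sum_comm]
    abel
  rw [h1]
  refine (norm_add_le _ _).trans (add_le_add ?_ ?_)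
  · refine le_of_sq_le_sq ?_ (norm_nonneg _)
    rw [norm_sq_toInterior_sum σ x h hd]
    exact norm_row_le hT y hy _
  · refine (norm_sum_le _ _).trans ?_
    calc ∑ i, ‖T (x i - ∑ j, ract (y j) (d j i)) (h i)‖
        ≤ ∑ i, δ / (C + 1) * ‖h i‖ := by
          refine Finset.sum_le_sum fun i _ => (norm_le_of_cc hT _ _).trans ?_
          gcongr
          exact hxy i
      _ = δ / (C + 1) * C := by rw [← Finset.mul_sum]
      _ ≤ δ := by
          rw [div_mul_eq_mul_div, div_le_iff₀ (by positivity)]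
          nlinarith

/-- The operator `T̃ : E ⊗_σ H → H`, `T̃ (x ⊗ h) = T(x) h`, as the continuous extension of the map
on algebraic tensors. -/
def tilde (T : E →ₗ[ℂ] (H →L[ℂ] H)) : InteriorTensor σ E →L[ℂ] H :=
  (preTilde T).extendOfNorm (toInterior σ E)

/-- For a completely contractive covariant `T` the extension exists: `T̃ (x ⊗ h) = T(x) h`. -/
lemma tilde_tmul (hT : IsCompletelyContractive A T)
    (hσ : ∀ x a, T (ract x a) = T x ∘L σ a) (x : E) (h : H) :
    tilde σ T (tmul σ x h) = T x h := by
  rw [tilde, tmul, LinearMap.extendOfNorm_eq (denseRange_toInterior σ)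
    ⟨1, fun u => by simpa using norm_preTilde_le σ hT hσ u⟩, preTilde_tmul]

lemma norm_tilde_le (hT : IsCompletelyContractive A T)
    (hσ : ∀ x a, T (ract x a) = T x ∘L σ a) : ‖tilde σ T‖ ≤ 1 :=
  LinearMap.opNorm_extendOfNorm_le (denseRange_toInterior σ) zero_le_one
    fun u => by simpa using norm_preTilde_le σ hT hσ u

/-- On algebraic tensors, `x ⊗ h ↦ x ⊗ W h`. -/
def preTensorMap (E : Type uE) [NormedAddCommGroup E] [NormedSpace ℂ E] {K : Type uK}
    [NormedAddCommGroup K] [InnerProductSpace ℂ K] (W : H →L[ℂ] K) :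
    E ⊗[ℂ] H →ₗ[ℂ] E ⊗[ℂ] K :=
  TensorProduct.map LinearMap.id W.toLinearMap

section TensorMap

variable {K : Type uK} [NormedAddCommGroup K] [InnerProductSpace ℂ K] [CompleteSpace K]
variable (ρ : A →⋆ₙₐ[ℂ] (K →L[ℂ] K))

variable (E) in
/-- The operator `I_E ⊗ W : E ⊗_σ H → E ⊗_ρ K`, `x ⊗ h ↦ x ⊗ W h`, as the continuous extension of
the map on algebraic tensors; it exists whenever `W` intertwines `σ` and `ρ`. -/
def tensorMap (W : H →L[ℂ] K) : InteriorTensor σ E →L[ℂ] InteriorTensor ρ E :=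
  ((toInterior ρ E).comp (preTensorMap E W)).extendOfNorm (toInterior σ E)

lemma norm_preTensorMap_le {W : H →L[ℂ] K} (hW : ∀ a, W ∘L σ a = ρ a ∘L W) (u : E ⊗[ℂ] H) :
    ‖toInterior ρ E (preTensorMap E W u)‖ ≤ ‖W‖ * ‖toInterior σ E u‖ := by
  obtain ⟨n, x, h, rfl⟩ := exists_fin_sum u
  obtain ⟨d, hd, -⟩ := exists_gram_eq (A := A) x
  have h1 : preTensorMap E W (∑ i, x i ⊗ₜ h i) = ∑ i, x i ⊗ₜ W (h i) := by
    simp [preTensorMap]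
  refine le_of_sq_le_sq ?_ (by positivity)
  rw [h1, mul_pow, norm_sq_toInterior_sum σ x h hd, norm_sq_toInterior_sum ρ x _ hd,
    Finset.mul_sum]
  refine Finset.sum_le_sum fun k _ => ?_
  have h2 : ∑ j, ρ (d k j) (W (h j)) = W (∑ j, σ (d k j) (h j)) := by
    rw [map_sum]
    exact Finset.sum_congr rfl fun j _ => (DFunLike.congr_fun (hW (d k j)) (h j)).symm
  rw [h2, ← mul_pow]
  gcongr
  exact W.le_opNorm _

lemma tensorMap_tmul {W : H →L[ℂ] K} (hW : ∀ a, W ∘L σ a = ρ a ∘L W) (x : E) (h : H) :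
    tensorMap σ E ρ W (tmul σ x h) = tmul ρ x (W h) := by
  rw [tensorMap, tmul, LinearMap.extendOfNorm_eq (denseRange_toInterior σ)
    ⟨‖W‖, fun u => norm_preTensorMap_le σ ρ hW u⟩]
  simp [preTensorMap, tmul]

end TensorMap

end Tensor

section ProductSystems

open Correspondence

/-- A (discrete) product system of correspondences over `A`, indexed by a commutative monoid `S`
(the fibres `X s` being correspondences over `A`).  The total space `Σ s, X s` is a semigroup over
`S`; `X 0` is a copy of `A`, acting on the fibres by the left and right actions; and for
`s, t ≠ 0` the multiplication `X s × X t → X (s + t)` extends to an isomorphism of correspondences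
from the balanced tensor product `X s ⊗_A X t`, i.e. from the Hausdorff completion of the
algebraic tensor product for `⟨x ⊗ y, w ⊗ z⟩ = ⟨y, ⟨x, w⟩ z⟩`, onto `X (s + t)`: it is bilinear, a
bimodule map, preserves that inner product, and the products span a dense subspace. -/
class ProductSystem (A : Type uA) [NonUnitalCStarAlgebra A] [PartialOrder A]
    {S : Type uΩ} [AddCommMonoid S] (X : S → Type uX) [∀ s, NormedAddCommGroup (X s)]
    [∀ s, NormedSpace ℂ (X s)] [∀ s, Correspondence A (X s)] where
  /-- the multiplication `X s × X t → X (s + t)` -/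
  mul : ∀ {s t : S}, X s →ₗ[ℂ] X t →ₗ[ℂ] X (s + t)
  mul_assoc : ∀ {s t r : S} (x : X s) (y : X t) (z : X r),
    (⟨s + t + r, mul (mul x y) z⟩ : Σ s, X s) = ⟨s + (t + r), mul x (mul y z)⟩
  /-- the identification `A = X 0` -/
  unit : A ≃ₗ[ℂ] X 0
  ip_unit : ∀ a b : A, ip (unit a) (unit b) = star a * b
  lact_unit : ∀ a b : A, lact a (unit b) = unit (a * b)
  ract_unit : ∀ a b : A, ract (unit a) b = unit (a * b)
  unit_mul : ∀ {s : S} (a : A) (x : X s),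
    (⟨0 + s, mul (unit a) x⟩ : Σ s, X s) = ⟨s, lact a x⟩
  mul_unit : ∀ {s : S} (x : X s) (a : A),
    (⟨s + 0, mul x (unit a)⟩ : Σ s, X s) = ⟨s, ract x a⟩
  lact_mul' : ∀ {s t : S}, s ≠ 0 → t ≠ 0 → ∀ (a : A) (x : X s) (y : X t),
    lact a (mul x y) = mul (lact a x) y
  ract_mul' : ∀ {s t : S}, s ≠ 0 → t ≠ 0 → ∀ (x : X s) (y : X t) (a : A),
    ract (mul x y) a = mul x (ract y a)
  ip_mul : ∀ {s t : S}, s ≠ 0 → t ≠ 0 → ∀ (x w : X s) (y z : X t),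
    ip (A := A) (mul x y) (mul w z) = ip y (lact (ip (A := A) x w) z)
  dense_mul : ∀ {s t : S}, s ≠ 0 → t ≠ 0 →
    Dense (Submodule.span ℂ {p : X (s + t) | ∃ (x : X s) (y : X t), p = mul x y} :
      Set (X (s + t)))

open ProductSystem

/-- A product system is essential if `A X(s)` is (linearly) dense in `X(s)` for all `s`. -/
def IsEssential (A : Type uA) [NonUnitalCStarAlgebra A] [PartialOrder A]
    {S : Type uΩ} (X : S → Type uX) [∀ s, NormedAddCommGroup (X s)]
    [∀ s, NormedSpace ℂ (X s)] [∀ s, Correspondence A (X s)] : Prop :=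
  ∀ s, Dense (Submodule.span ℂ {p : X s | ∃ (a : A) (x : X s), p = lact a x} : Set (X s))

/-- A `*`-homomorphism `σ : A → B(H)` is nondegenerate if `σ(A)H` is (linearly) dense in `H`. -/
def IsNondegenerate {A : Type uA} [NonUnitalCStarAlgebra A] {H : Type uH} [NormedAddCommGroup H]
    [InnerProductSpace ℂ H] [CompleteSpace H] (σ : A →⋆ₙₐ[ℂ] (H →L[ℂ] H)) : Prop :=
  Dense (Submodule.span ℂ {h : H | ∃ (a : A) (g : H), h = σ a g} : Set H)

/-- A completely contractive covariant representation of the product system `X` on `H`, with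
`σ = T_0`.  Nondegeneracy of `σ` is not part of this structure; it is the separate predicate
`IsNondegenerate σ`. -/
structure Representation (A : Type uA) [NonUnitalCStarAlgebra A] [PartialOrder A]
    [StarOrderedRing A] {S : Type uΩ} [AddCommMonoid S] (X : S → Type uX)
    [∀ s, NormedAddCommGroup (X s)] [∀ s, NormedSpace ℂ (X s)] [∀ s, Correspondence A (X s)]
    [ProductSystem A X]
    (H : Type uH) [NormedAddCommGroup H] [InnerProductSpace ℂ H] [CompleteSpace H] where
  /-- the `*`-homomorphism `σ : A → B(H)` -/
  σ : A →⋆ₙₐ[ℂ] (H →L[ℂ] H)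
  /-- the maps `T_s : X s → B(H)` -/
  T : ∀ s, X s →ₗ[ℂ] (H →L[ℂ] H)
  T_unit : ∀ a : A, T 0 (unit a) = σ a
  completelyContractive : ∀ s, IsCompletelyContractive A (T s)
  T_ract : ∀ s (x : X s) (a : A), T s (ract x a) = T s x ∘L σ a
  T_lact : ∀ s (a : A) (x : X s), T s (lact a x) = σ a ∘L T s x
  T_mul : ∀ s t (x : X s) (y : X t), T (s + t) (mul (A := A) x y) = T s x ∘L T t y

variable {A : Type uA} [NonUnitalCStarAlgebra A] [PartialOrder A] [StarOrderedRing A]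
  {S : Type uΩ} [AddCommMonoid S] {X : S → Type uX} [∀ s, NormedAddCommGroup (X s)]
  [∀ s, NormedSpace ℂ (X s)] [∀ s, Correspondence A (X s)] [ProductSystem A X]
  {H : Type uH} [NormedAddCommGroup H] [InnerProductSpace ℂ H] [CompleteSpace H]

namespace Representation

/-- An isometric representation: `T_s(x)* T_s(y) = σ(⟨x, y⟩)` on every fibre. -/
def IsIsometric (π : Representation A X H) : Prop :=
  ∀ s (x y : X s), (π.T s x)† ∘L π.T s y = π.σ (ip x y)

/-- The operator `T̃_s : X(s) ⊗_σ H → H`, `x ⊗ h ↦ T_s(x) h`. -/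
def tilde (π : Representation A X H) (s : S) : InteriorTensor π.σ (X s) →L[ℂ] H :=
  ProductSystemDilation.tilde π.σ (π.T s)

lemma tilde_tmul (π : Representation A X H) (s : S) (x : X s) (h : H) :
    π.tilde s (tmul π.σ x h) = π.T s x h :=
  ProductSystemDilation.tilde_tmul π.σ (π.completelyContractive s) (π.T_ract s) x h

lemma norm_tilde_apply_le (π : Representation A X H) (s : S) (ξ : InteriorTensor π.σ (X s)) :
    ‖π.tilde s ξ‖ ≤ ‖ξ‖ := by
  simpa using (π.tilde s).le_of_opNorm_le
    (norm_tilde_le π.σ (π.completelyContractive s) (π.T_ract s)) ξ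

/-- The algebraic version of `U_{u,s} ⊗ I : X(u) ⊗ X(s) ⊗ H → X(u+s) ⊗_σ H`,
`x ⊗ (y ⊗ h) ↦ xy ⊗ h`. -/
def blockSource (π : Representation A X H) (u s : S) :
    X u ⊗[ℂ] (X s ⊗[ℂ] H) →ₗ[ℂ] InteriorTensor π.σ (X (u + s)) :=
  TensorProduct.lift <| ((toInterior π.σ (X (u + s))).compRight ℂ).comp
    ((LinearMap.rTensorHom H).comp (mul (A := A) (X := X) (s := u) (t := s)))

/-- The algebraic version of `I ⊗ T̃_s : X(u) ⊗ X(s) ⊗ H → X(u) ⊗_σ H`,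
`x ⊗ (y ⊗ h) ↦ x ⊗ T_s(y) h`. -/
def blockTarget (π : Representation A X H) (u s : S) :
    X u ⊗[ℂ] (X s ⊗[ℂ] H) →ₗ[ℂ] InteriorTensor π.σ (X u) :=
  (toInterior π.σ (X u)).comp (TensorProduct.map LinearMap.id (preTilde (π.T s)))

lemma blockSource_tmul (π : Representation A X H) (u s : S) (x : X u) (k : X s ⊗[ℂ] H) :
    π.blockSource u s (x ⊗ₜ k) =
      toInterior π.σ (X (u + s)) ((mul (A := A) (X := X) x).rTensor H k) := by
  simp [blockSource]

lemma blockTarget_tmul (π : Representation A X H) (u s : S) (x : X u) (k : X s ⊗[ℂ] H) :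
    π.blockTarget u s (x ⊗ₜ k) = toInterior π.σ (X u) (x ⊗ₜ preTilde (π.T s) k) := by
  simp [blockTarget]

/-- For `u, s ≠ 0`, the block `(I_{X(u)} ⊗ T̃_s)(U_{u,s}⁻¹ ⊗ I_H) : X(u+s) ⊗_σ H → X(u) ⊗_σ H` of
`T̂_s`, i.e. the continuous operator with `xy ⊗ h ↦ x ⊗ T_s(y) h` for `x ∈ X(u)`, `y ∈ X(s)`. -/
def block (π : Representation A X H) (u s : S) :
    InteriorTensor π.σ (X (u + s)) →L[ℂ] InteriorTensor π.σ (X u) :=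
  (π.blockTarget u s).extendOfNorm (π.blockSource u s)

variable (π : Representation A X H) {u s : S}

lemma inner_blockSource (hu : u ≠ 0) (hs : s ≠ 0) (x w : X u) (k l : X s ⊗[ℂ] H) :
    ⟪π.blockSource u s (x ⊗ₜ k), π.blockSource u s (w ⊗ₜ l)⟫_ℂ =
      tensorForm π.σ (X s) k ((lact (ip (A := A) x w)).rTensor H l) := by
  rw [blockSource_tmul, blockSource_tmul, inner_toInterior]
  induction k with
  | zero => simp
  | add k k' hk hk' => simp [hk, hk']
  | tmul y h =>
    induction l with
    | zero => simp
    | add l l' hl hl' => simp_all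
    | tmul z g => simp [ip_mul hu hs]

lemma tensorForm_lact (σ : A →⋆ₙₐ[ℂ] (H →L[ℂ] H)) (a : A) (k l : X s ⊗[ℂ] H) :
    tensorForm σ (X s) k ((lact (star a)).rTensor H l) =
      tensorForm σ (X s) ((lact a).rTensor H k) l := by
  induction k with
  | zero => simp
  | add k k' hk hk' => simp [hk, hk']
  | tmul y h =>
    induction l with
    | zero => simp
    | add l l' hl hl' => simp_all
    | tmul z g => simp [ip_lact_left]

lemma preTilde_lact (a : A) (k : X s ⊗[ℂ] H) :
    preTilde (π.T s) ((lact a).rTensor H k) = π.σ a (preTilde (π.T s) k) := by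
  induction k with
  | zero => simp
  | add k k' hk hk' => simp [hk, hk']
  | tmul y h => simp [π.T_lact]

lemma norm_sq_blockSource_sum (hu : u ≠ 0) (hs : s ≠ 0) {ι : Type} [Fintype ι] (x : ι → X u)
    (k : ι → X s ⊗[ℂ] H) {d : CStarMatrix ι ι A}
    (hd : ∀ i j, ip (x i) (x j) = ∑ k, star (d k i) * d k j) :
    ‖π.blockSource u s (∑ i, x i ⊗ₜ k i)‖ ^ 2 =
      ∑ m, ‖toInterior π.σ (X s) (∑ j, (lact (d m j)).rTensor H (k j))‖ ^ 2 := by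
  have key : ⟪π.blockSource u s (∑ i, x i ⊗ₜ k i), π.blockSource u s (∑ i, x i ⊗ₜ k i)⟫_ℂ =
      ∑ m, ⟪toInterior π.σ (X s) (∑ j, (lact (d m j)).rTensor H (k j)),
        toInterior π.σ (X s) (∑ j, (lact (d m j)).rTensor H (k j))⟫_ℂ := by
    have h1 : ∀ i j, tensorForm π.σ (X s) (k i)
        ((lact (ip (A := A) (x i) (x j)) : X s →ₗ[ℂ] X s).rTensor H (k j)) =
        ∑ m, tensorForm π.σ (X s) ((lact (d m i)).rTensor H (k i))
          ((lact (d m j)).rTensor H (k j)) := by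
      intro i j
      have : ∀ m, (lact (star (d m i) * d m j) : X s →ₗ[ℂ] X s) =
          lact (star (d m i)) ∘ₗ lact (d m j) := by
        intro m; ext y; exact lact_mul _ _ _
      rw [hd i j, map_sum, ← LinearMap.coe_rTensorHom, map_sum, LinearMap.sum_apply, map_sum]
      refine Finset.sum_congr rfl fun m _ => ?_
      simp only [LinearMap.coe_rTensorHom]
      rw [← tensorForm_lact, this, LinearMap.rTensor_comp]
      rfl
    have h2 : ∀ m, ⟪toInterior π.σ (X s) (∑ j, (lact (d m j)).rTensor H (k j)),
        toInterior π.σ (X s) (∑ j, (lact (d m j)).rTensor H (k j))⟫_ℂ =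
        ∑ i, ∑ j, tensorForm π.σ (X s) ((lact (d m i)).rTensor H (k i))
          ((lact (d m j)).rTensor H (k j)) := by
      intro m
      rw [map_sum, sum_inner]
      refine Finset.sum_congr rfl fun i _ => ?_
      rw [inner_sum]
      exact Finset.sum_congr rfl fun j _ => inner_toInterior _ _ _
    simp only [h2]
    rw [map_sum, sum_inner, Finset.sum_comm]
    refine Finset.sum_congr rfl fun i _ => ?_
    rw [inner_sum, Finset.sum_comm]
    refine Finset.sum_congr rfl fun j _ => ?_
    rw [inner_blockSource π hu hs, h1]
  have := congrArg Complex.re key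
  rw [Complex.re_sum] at this
  calc ‖π.blockSource u s (∑ i, x i ⊗ₜ k i)‖ ^ 2 = _ :=
        (inner_self_eq_norm_sq (𝕜 := ℂ) _).symm
    _ = _ := this
    _ = _ := Finset.sum_congr rfl fun m _ => inner_self_eq_norm_sq (𝕜 := ℂ) _

lemma norm_blockTarget_le (hu : u ≠ 0) (hs : s ≠ 0) (w : X u ⊗[ℂ] (X s ⊗[ℂ] H)) :
    ‖π.blockTarget u s w‖ ≤ ‖π.blockSource u s w‖ := by
  obtain ⟨n, x, k, rfl⟩ := exists_fin_sum w
  obtain ⟨d, hd, -⟩ := exists_gram_eq (A := A) x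
  refine le_of_sq_le_sq ?_ (norm_nonneg _)
  rw [norm_sq_blockSource_sum π hu hs x k hd]
  have h1 : π.blockTarget u s (∑ i, x i ⊗ₜ k i) =
      toInterior π.σ (X u) (∑ i, x i ⊗ₜ preTilde (π.T s) (k i)) := by
    simp [blockTarget]
  rw [h1, norm_sq_toInterior_sum π.σ x _ hd]
  refine Finset.sum_le_sum fun m _ => ?_
  have h2 : ∑ j, π.σ (d m j) (preTilde (π.T s) (k j)) =
      preTilde (π.T s) (∑ j, (lact (d m j)).rTensor H (k j)) := by
    simp [preTilde_lact]
  rw [h2]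
  gcongr
  exact norm_preTilde_le π.σ (π.completelyContractive s) (π.T_ract s) _

lemma denseRange_blockSource (hu : u ≠ 0) (hs : s ≠ 0) : DenseRange (π.blockSource u s) := by
  set P := (LinearMap.range (π.blockSource u s)).topologicalClosure with hP
  have hPc : IsClosed (P : Set (InteriorTensor π.σ (X (u + s)))) :=
    Submodule.isClosed_topologicalClosure _
  have h1 : ∀ (z : X (u + s)) (h : H), tmul π.σ z h ∈ P := by
    intro z h
    set f : X (u + s) →L[ℂ] InteriorTensor π.σ (X (u + s)) :=
      ((toInterior π.σ (X (u + s))).comp ((TensorProduct.mk ℂ (X (u + s)) H).flip h)).mkContinuous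
        ‖h‖ (fun z => by
          rw [mul_comm]; exact norm_tmul_le π.σ z h) with hf
    have h2 : (Submodule.span ℂ {p : X (u + s) | ∃ (x : X u) (y : X s), p = mul (A := A) x y}) ≤
        P.comap f.toLinearMap := by
      rw [Submodule.span_le]
      rintro _ ⟨x, y, rfl⟩
      refine Submodule.le_topologicalClosure _ ⟨x ⊗ₜ (y ⊗ₜ h), ?_⟩
      rw [blockSource_tmul, LinearMap.rTensor_tmul]
      rfl
    have h3 : IsClosed (P.comap f.toLinearMap : Set (X (u + s))) := hPc.preimage f.continuous
    have h4 := h3.closure_subset_iff.2 h2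
    rw [(dense_mul (A := A) (X := X) hu hs).closure_eq] at h4
    exact h4 (Set.mem_univ z)
  have h5 : ∀ w, toInterior π.σ (X (u + s)) w ∈ P := by
    intro w
    induction w with
    | zero => simp
    | add w w' hw hw' => rw [map_add]; exact P.add_mem hw hw'
    | tmul z h => exact h1 z h
  have h6 := hPc.closure_subset_iff.2 (Set.range_subset_iff.2 h5)
  rw [(denseRange_toInterior π.σ).closure_eq] at h6
  intro ξ
  have := h6 (Set.mem_univ ξ)
  rwa [hP, SetLike.mem_coe, ← SetLike.mem_coe, Submodule.topologicalClosure_coe,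
    LinearMap.coe_range] at this

/-- The defining formula of the blocks of `T̂_s`. -/
lemma block_tmul (hu : u ≠ 0) (hs : s ≠ 0) (x : X u) (y : X s) (h : H) :
    π.block u s (tmul π.σ (mul (A := A) x y) h) = tmul π.σ x (π.T s y h) := by
  have h1 : tmul π.σ (mul (A := A) x y) h = π.blockSource u s (x ⊗ₜ (y ⊗ₜ h)) := by
    rw [blockSource_tmul]; simp [tmul]
  rw [h1, block, LinearMap.extendOfNorm_eq (π.denseRange_blockSource hu hs)
    ⟨1, fun w => by simpa using π.norm_blockTarget_le hu hs w⟩, blockTarget_tmul, preTilde_tmul]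
  rfl

lemma norm_block_apply_le (hu : u ≠ 0) (hs : s ≠ 0) (ξ : InteriorTensor π.σ (X (u + s))) :
    ‖π.block u s ξ‖ ≤ ‖ξ‖ := by
  rw [block]
  simpa only [one_mul] using LinearMap.norm_extendOfNorm_apply_le (π.denseRange_blockSource hu hs) 1
    (fun w => by simpa using π.norm_blockTarget_le hu hs w) ξ

end Representation

end ProductSystems

section Hat

open ProductSystem

variable {A : Type uA} [NonUnitalCStarAlgebra A] [PartialOrder A] [StarOrderedRing A]
  {S : Type uΩ} [AddCommMonoid S] {X : S → Type uX} [∀ s, NormedAddCommGroup (X s)]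
  [∀ s, NormedSpace ℂ (X s)] [∀ s, Correspondence A (X s)] [ProductSystem A X]
  {H : Type uH} [NormedAddCommGroup H] [InnerProductSpace ℂ H] [CompleteSpace H]

namespace Representation

/-- The part `⊕_{s ≠ 0} X(s) ⊗_σ H` (Hilbert space direct sum) of the space `𝓗`. -/
abbrev HatTail (π : Representation A X H) : Type (max uΩ uX uH) :=
  lp (fun s : {s : S // s ≠ 0} => InteriorTensor π.σ (X s)) 2

/-- The Hilbert space `𝓗 = H ⊕ (⊕_{s ≠ 0} X(s) ⊗_σ H)`.  Its elements are pairs `(h, f)`, where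
`h` is the value at `0` and `f s` the value at `s ≠ 0`. -/
abbrev HatSpace (π : Representation A X H) : Type (max uΩ uX uH) := WithLp 2 (H × π.HatTail)

variable [IsCancelAdd S] [Subsingleton (AddUnits S)]

lemma add_ne_zero_of_left {u s : S} (hu : u ≠ 0) : u + s ≠ 0 := fun h =>
  hu (add_eq_zero.1 h).1

variable (π : Representation A X H)

/-- The value of `T̂_s (h, f)` at `u ≠ 0`: the block `X(u+s) ⊗ H → X(u) ⊗ H` applied to the value
`f (u + s)`. -/
def hatTailFun (s : S) (f : π.HatTail) (u : {u : S // u ≠ 0}) : InteriorTensor π.σ (X u) :=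
  π.block u s (f ⟨u + s, add_ne_zero_of_left u.2⟩)

/-- The index `u + s` from which `T̂_s` takes its value at `u` (`none` stands for `u = 0`). -/
def shift {s : S} (hs : s ≠ 0) : Option {u : S // u ≠ 0} → {u : S // u ≠ 0}
  | none => ⟨s, hs⟩
  | some u => ⟨u + s, add_ne_zero_of_left u.2⟩

lemma shift_injective {s : S} (hs : s ≠ 0) : Function.Injective (shift hs) := by
  rintro (_ | u) (_ | v) h
  · rfl
  · exfalso
    have h' : s = v.1 + s := congrArg Subtype.val h
    exact v.2 (by simpa using h'.symm)
  · exfalso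
    have h' : u.1 + s = s := congrArg Subtype.val h
    exact u.2 (by simpa using h')
  · have h' : u.1 + s = v.1 + s := congrArg Subtype.val h
    exact congrArg some (Subtype.ext (add_right_cancel h'))

lemma summable_sq (f : π.HatTail) : Summable fun i => ‖f i‖ ^ 2 := by
  simpa using (lp.memℓp f).summable (by norm_num)

lemma norm_sq_tail (f : π.HatTail) : ‖f‖ ^ 2 = ∑' i, ‖f i‖ ^ 2 := by
  simpa using lp.norm_rpow_eq_tsum (p := 2) (by norm_num) f

lemma norm_sq_hatTailFun_le {s : S} (hs : s ≠ 0) (f : π.HatTail) (u : {u : S // u ≠ 0}) :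
    ‖π.hatTailFun s f u‖ ^ 2 ≤ ‖f (shift hs (some u))‖ ^ 2 := by
  gcongr
  exact π.norm_block_apply_le u.2 hs _

lemma summable_shift {s : S} (hs : s ≠ 0) (f : π.HatTail) :
    Summable fun u => ‖f (shift hs (some u))‖ ^ 2 :=
  ((π.summable_sq f).comp_injective (shift_injective hs)).comp_injective
    (Option.some_injective _)

lemma summable_hatTailFun {s : S} (hs : s ≠ 0) (f : π.HatTail) :
    Summable fun u => ‖π.hatTailFun s f u‖ ^ 2 :=
  (π.summable_shift hs f).of_nonneg_of_le (fun _ => by positivity)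
    (π.norm_sq_hatTailFun_le hs f)

/-- The operator `f ↦ (u ↦ (T̂_s f)(u))` on `⊕_{u ≠ 0} X(u) ⊗ H`. -/
def hatTail {s : S} (hs : s ≠ 0) : π.HatTail →ₗ[ℂ] π.HatTail where
  toFun f := ⟨π.hatTailFun s f, memℓp_gen (by simpa using π.summable_hatTailFun hs f)⟩
  map_add' f g := by ext u; exact map_add (π.block u s) _ _
  map_smul' c f := by ext u; exact map_smul (π.block u s) c _

/-- `T̂_s` for `s ≠ 0`, as a linear map. -/
def hatLin {s : S} (hs : s ≠ 0) : π.HatSpace →ₗ[ℂ] π.HatSpace where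
  toFun z := WithLp.toLp 2 (π.tilde s (z.snd ⟨s, hs⟩), π.hatTail hs z.snd)
  map_add' z w := by
    apply WithLp.ofLp_injective
    simp
  map_smul' c z := by
    apply WithLp.ofLp_injective
    simp

lemma norm_hatLin_le {s : S} (hs : s ≠ 0) (z : π.HatSpace) : ‖π.hatLin hs z‖ ≤ ‖z‖ := by
  classical
  refine le_of_sq_le_sq ?_ (norm_nonneg _)
  rw [WithLp.prod_norm_sq_eq_of_L2, WithLp.prod_norm_sq_eq_of_L2]
  have h1 : ‖(π.hatLin hs z).fst‖ ^ 2 ≤ ‖z.snd (shift hs none)‖ ^ 2 := by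
    gcongr
    exact π.norm_tilde_apply_le s _
  have h2 : ‖(π.hatLin hs z).snd‖ ^ 2 ≤ ∑' u, ‖z.snd (shift hs (some u))‖ ^ 2 := by
    rw [norm_sq_tail]
    exact (π.summable_hatTailFun hs z.snd).tsum_le_tsum (π.norm_sq_hatTailFun_le hs z.snd)
      (π.summable_shift hs z.snd)
  have h3 : ‖z.snd (shift hs none)‖ ^ 2 + ∑' u, ‖z.snd (shift hs (some u))‖ ^ 2 ≤
      ‖z.snd‖ ^ 2 := by
    rw [norm_sq_tail]
    have h4 : Summable fun o => ‖z.snd (shift hs o)‖ ^ 2 :=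
      (π.summable_sq z.snd).comp_injective (shift_injective hs)
    have h5 : ∑' o, ‖z.snd (shift hs o)‖ ^ 2 =
        ‖z.snd (shift hs none)‖ ^ 2 + ∑' u, ‖z.snd (shift hs (some u))‖ ^ 2 := by
      rw [h4.tsum_eq_add_tsum_ite none, ← (Option.some_injective _).tsum_eq]
      · simp
      · rintro (_ | u) hu
        · simp at hu
        · exact ⟨u, rfl⟩
    rw [← h5]
    exact tsum_comp_le_tsum_of_inj (π.summable_sq z.snd) (fun _ => by positivity)
      (shift_injective hs)
  nlinarith [sq_nonneg ‖z.fst‖]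

open Classical in
/-- The contraction semigroup `T̂` on `𝓗` associated with the representation.  `T̂_0 = I`, and for
`s ≠ 0` the component of `T̂_s f` at `0` is `T̃_s (f s)`, and at `u ≠ 0` it is
`(I ⊗ T̃_s)(U_{u,s}⁻¹ ⊗ I) (f (u + s))`.  In other words
`T̂_s (δ_s · ξ) = δ_0 · T̃_s ξ`, `T̂_s (δ_t · (xy ⊗ h)) = δ_{t-s} · (x ⊗ T_s(y) h)` for
`x ∈ X(t-s)`, `y ∈ X(s)`, `t > s`, and `T̂_s (δ_t · ξ) = 0` if `t` is not of the form `u + s`. -/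
def hat (s : S) : π.HatSpace →L[ℂ] π.HatSpace :=
  if hs : s = 0 then ContinuousLinearMap.id ℂ _
  else (π.hatLin hs).mkContinuous 1 fun z => by simpa using π.norm_hatLin_le hs z

lemma hat_zero : π.hat 0 = ContinuousLinearMap.id ℂ _ := dif_pos rfl

lemma hat_fst {s : S} (hs : s ≠ 0) (z : π.HatSpace) :
    (π.hat s z).fst = π.tilde s (z.snd ⟨s, hs⟩) := by
  rw [hat, dif_neg hs]; rfl

lemma hat_snd {s : S} (hs : s ≠ 0) (z : π.HatSpace) (u : {u : S // u ≠ 0}) :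
    (π.hat s z).snd u = π.block u s (z.snd ⟨u + s, add_ne_zero_of_left u.2⟩) := by
  rw [hat, dif_neg hs]; rfl

lemma norm_hat_apply_le (s : S) (z : π.HatSpace) : ‖π.hat s z‖ ≤ ‖z‖ := by
  by_cases hs : s = 0
  · subst hs; simp [hat_zero]
  · rw [hat, dif_neg hs]; exact π.norm_hatLin_le hs z

end Representation

end Hat

section Semigroup

variable {Ω : Type uΩ}

/-- A submonoid of `ℝ₊` is commensurable if any finitely many elements of it are natural multiples
of one element of it. -/
def IsCommensurable (M : AddSubmonoid ℝ≥0) : Prop :=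
  ∀ F : Finset ℝ≥0, (∀ r ∈ F, r ∈ M) → ∃ r₀ ∈ M, ∀ r ∈ F, ∃ a : ℕ, r = a • r₀

/-- The semigroup `𝓢 = ∑_{i ∈ Ω} 𝓢_i` of finitely supported functions `s` with `s j ∈ 𝓢_j`. -/
def sumSemigroup (S : Ω → AddSubmonoid ℝ≥0) : AddSubmonoid (Ω →₀ ℝ≥0) where
  carrier := {s | ∀ j, s j ∈ S j}
  zero_mem' j := (S j).zero_mem
  add_mem' hs ht j := (S j).add_mem (hs j) (ht j)

instance (S : Ω → AddSubmonoid ℝ≥0) : Subsingleton (AddUnits (sumSemigroup S)) := by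
  refine subsingleton_of_forall_eq 0 fun a => AddUnits.ext (Subtype.ext (Finsupp.ext fun j => ?_))
  have h := congrArg (fun s : sumSemigroup S => (s : Ω →₀ ℝ≥0) j) a.val_neg
  exact (add_eq_zero.1 h).1

/-- The subgroup `𝓢 - 𝓢` of `ℝ^Ω` generated by `𝓢`. -/
def differences (S : Ω → AddSubmonoid ℝ≥0) : AddSubgroup (Ω → ℝ) :=
  AddSubgroup.closure (Set.range fun (s : sumSemigroup S) (j : Ω) => ((s : Ω →₀ ℝ≥0) j : ℝ))

lemma exists_eq_sub {S : Ω → AddSubmonoid ℝ≥0} {s : Ω → ℝ} (hs : s ∈ differences S) :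
    ∃ p q : sumSemigroup S, ∀ j, s j = (p : Ω →₀ ℝ≥0) j - (q : Ω →₀ ℝ≥0) j := by
  induction hs using AddSubgroup.closure_induction with
  | mem x hx => obtain ⟨p, rfl⟩ := hx; exact ⟨p, 0, fun j => by simp⟩
  | zero => exact ⟨0, 0, fun j => by simp⟩
  | add x y _ _ hx hy =>
    obtain ⟨p, q, h⟩ := hx
    obtain ⟨p', q', h'⟩ := hy
    exact ⟨p + p', q + q', fun j => by simp [h j, h' j]; ring⟩
  | neg x _ hx =>
    obtain ⟨p, q, h⟩ := hx
    exact ⟨q, p, fun j => by simp [h j]⟩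

lemma tsub_mem {M : AddSubmonoid ℝ≥0} (hM : IsCommensurable M) {p q : ℝ≥0} (hp : p ∈ M)
    (hq : q ∈ M) : p - q ∈ M := by
  classical
  obtain ⟨r, hr, h⟩ := hM {p, q} (by simp [hp, hq])
  obtain ⟨a, ha⟩ := h p (by simp)
  obtain ⟨b, hb⟩ := h q (by simp)
  have : p - q = (a - b) • r := by
    rw [ha, hb, nsmul_eq_mul, nsmul_eq_mul, nsmul_eq_mul, Nat.cast_tsub, tsub_mul]
  rw [this]
  exact M.nsmul_mem hr _

/-- In `𝓢`, `s ≤ t` pointwise iff `t = u + s` for some `u ∈ 𝓢`. -/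
lemma le_iff_exists_add {S : Ω → AddSubmonoid ℝ≥0} (hS : ∀ i, IsCommensurable (S i))
    (s t : sumSemigroup S) :
    (∀ j, (s : Ω →₀ ℝ≥0) j ≤ (t : Ω →₀ ℝ≥0) j) ↔ ∃ u : sumSemigroup S, t = u + s := by
  constructor
  · intro h
    refine ⟨⟨t - s, fun j => tsub_mem (hS j) (t.2 j) (s.2 j)⟩, ?_⟩
    ext j
    simp [tsub_add_cancel_of_le (h j)]
  · rintro ⟨u, rfl⟩ j
    simp

/-- The positive part `s₊ ∈ 𝓢`, `s₊(j) = max {0, s(j)}`, of `s ∈ 𝓢 - 𝓢`. -/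
def pos {S : Ω → AddSubmonoid ℝ≥0} (hS : ∀ i, IsCommensurable (S i)) (s : Ω → ℝ)
    (hs : s ∈ differences S) : sumSemigroup S :=
  ⟨Finsupp.ofSupportFinite (fun j => Real.toNNReal (s j)) (by
      obtain ⟨p, q, h⟩ := exists_eq_sub hs
      refine (p : Ω →₀ ℝ≥0).hasFiniteSupport.subset fun j hj => ?_
      contrapose! hj
      have hp : (p : Ω →₀ ℝ≥0) j = 0 := by simpa using hj
      simp [h j, hp]),
    fun j => by
      obtain ⟨p, q, h⟩ := exists_eq_sub hs
      have : Real.toNNReal (s j) = (p : Ω →₀ ℝ≥0) j - (q : Ω →₀ ℝ≥0) j := by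
        rw [h j, ← NNReal.sub_def]
      change Real.toNNReal (s j) ∈ S j
      rw [this]
      exact tsub_mem (hS j) (p.2 j) (q.2 j)⟩

/-- The negative part `s₋ = s₊ - s = (-s)₊ ∈ 𝓢` of `s ∈ 𝓢 - 𝓢`. -/
def neg {S : Ω → AddSubmonoid ℝ≥0} (hS : ∀ i, IsCommensurable (S i)) (s : Ω → ℝ)
    (hs : s ∈ differences S) : sumSemigroup S :=
  pos hS (-s) ((differences S).neg_mem hs)

lemma pos_sub_neg {S : Ω → AddSubmonoid ℝ≥0} (hS : ∀ i, IsCommensurable (S i)) (s : Ω → ℝ)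
    (hs : s ∈ differences S) (j : Ω) :
    ((pos hS s hs : Ω →₀ ℝ≥0) j : ℝ) - s j = (neg hS s hs : Ω →₀ ℝ≥0) j := by
  change (Real.toNNReal (s j) : ℝ) - s j = Real.toNNReal (-(s j))
  rw [Real.coe_toNNReal', Real.coe_toNNReal']
  rcases le_total 0 (s j) with h | h
  · simp [h]
  · simp [h]

end Semigroup

section Dilations

variable {Ω : Type uΩ} {S : Ω → AddSubmonoid ℝ≥0} (hS : ∀ i, IsCommensurable (S i))
  {H : Type uH} [NormedAddCommGroup H] [InnerProductSpace ℂ H] [CompleteSpace H]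
  {K : Type uK} [NormedAddCommGroup K] [InnerProductSpace ℂ K] [CompleteSpace K]

/-- `V` is a semigroup of isometries over `𝓢` on the Hilbert space `K`. -/
structure IsIsometricSemigroup (V : sumSemigroup S → K →L[ℂ] K) : Prop where
  map_zero : V 0 = ContinuousLinearMap.id ℂ K
  map_add : ∀ s t, V (s + t) = V s ∘L V t
  isometry : ∀ s, Isometry (V s)

/-- For a family `T` of operators on `H` and a family `V` on a Hilbert space `K ⊇ H` (the inclusion
being the isometry `j`): `P_H V_{s₋}* V_{s₊}|_H = T_{s₋}* T_{s₊}` for all `s ∈ 𝓢 - 𝓢`.  Here `P_H`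
is `j*` as a map onto `H`, and restriction to `H` is composition with `j`. -/
def IsRegularDilation (T : sumSemigroup S → H →L[ℂ] H) (j : H →ₗᵢ[ℂ] K)
    (V : sumSemigroup S → K →L[ℂ] K) : Prop :=
  ∀ (s : Ω → ℝ) (hs : s ∈ differences S),
    (j.toContinuousLinearMap)† ∘L (V (neg hS s hs))† ∘L V (pos hS s hs) ∘L
      j.toContinuousLinearMap = (T (neg hS s hs))† ∘L T (pos hS s hs)

/-- The family `T` has a regular isometric dilation (on some Hilbert space in the universe
`uK`). -/
def HasRegularIsometricDilation (T : sumSemigroup S → H →L[ℂ] H) : Prop :=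
  ∃ (K : Type uK) (_ : NormedAddCommGroup K) (_ : InnerProductSpace ℂ K) (_ : CompleteSpace K)
    (j : H →ₗᵢ[ℂ] K) (V : sumSemigroup S → K →L[ℂ] K),
    IsIsometricSemigroup V ∧ IsRegularDilation hS T j V

variable {A : Type uA} [NonUnitalCStarAlgebra A] [PartialOrder A] [StarOrderedRing A]
  {X : sumSemigroup S → Type uX} [∀ s, NormedAddCommGroup (X s)]
  [∀ s, NormedSpace ℂ (X s)] [∀ s, Correspondence A (X s)] [ProductSystem A X]

/-- The canonical map `X(s) ⊗_σ H → X(s) ⊗_ρ K`, `x ⊗ h ↦ x ⊗ j h`, for representations `π` on `H`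
and `ν` on `K ⊇ H`.  If `j` intertwines `π.σ` and `ν.σ` it is an isometry, which identifies
`X(s) ⊗ H` with a closed subspace of `X(s) ⊗ K`; its adjoint is then the orthogonal projection
`P_{X(s) ⊗ H}`. -/
def fibreIncl (π : Representation A X H) (ν : Representation A X K) (j : H →ₗᵢ[ℂ] K)
    (s : sumSemigroup S) : InteriorTensor π.σ (X s) →L[ℂ] InteriorTensor ν.σ (X s) :=
  tensorMap π.σ (X s) ν.σ j.toContinuousLinearMap

/-- `P_{X(s₋) ⊗ H} Ṽ_{s₋}* Ṽ_{s₊}|_{X(s₊) ⊗ H} = T̃_{s₋}* T̃_{s₊}` for all `s ∈ 𝓢 - 𝓢`. -/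
def IsRegularDilationRep (π : Representation A X H) (j : H →ₗᵢ[ℂ] K)
    (ν : Representation A X K) : Prop :=
  ∀ (s : Ω → ℝ) (hs : s ∈ differences S),
    (fibreIncl π ν j (neg hS s hs))† ∘L (ν.tilde (neg hS s hs))† ∘L ν.tilde (pos hS s hs) ∘L
      fibreIncl π ν j (pos hS s hs) = (π.tilde (neg hS s hs))† ∘L π.tilde (pos hS s hs)

/-- The orthogonal projection `P_H` of `K` onto (the image of) `H`, as an operator on `K`. -/
def proj (j : H →ₗᵢ[ℂ] K) : K →L[ℂ] K :=
  j.toContinuousLinearMap ∘L (j.toContinuousLinearMap)†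

end Dilations

end ProductSystemDilation

end

/-! Let `V` be the given regular isometric dilation of `π.hat`, on a space containing `𝓗` through
`J`. In that space consider the vectors `v(x, h) = V_s J (δ_s · (x ⊗ h))` for `x ∈ X(s)`, with `δ_0
· σ(a) h` in place of the tensor when `s = 0` and `x` comes from `a ∈ A`, together with `v(1, h) = J
(δ_0 · h)` for a formal unit `1`. The formal unit is needed because `A` may have no unit and `σ` may
be degenerate. The dilating representation acts on the closed span `K` of these vectors by left
multiplication, `V_t(x) v(o, h) = v(x o, h)`, and `H` sits in `K` as the vectors `v(1, h)`.

Everything rests on one formula. Two degrees can be written `m + p` and `m + q` with `p`, `q` of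
disjoint supports, `m` being their pointwise minimum. The isometry `V_m` cancels in the inner
product, and regularity turns what is left into an inner product of `T̂_p z` and `T̂_q w` in `𝓗`.
Since `T̂_p` sends `δ_{m+p} · (y z ⊗ h)` to `δ_m · (y ⊗ T_p(z) h)`, this gives `⟨v(y o, h), v(y' o',
h')⟩ = ⟨o h, σ(⟨y, y'⟩) o' h'⟩` for `y, y' ∈ X(m)` and `o`, `o'` of disjoint degrees
(`inner_dilVec_act`), where `o h` means the action of `o` on `H` through `T`. Multiplying both
vectors from the left by `x`, `x'` in one fibre replaces `⟨y, y'⟩` by `⟨x y, x' y'⟩ = ⟨y, ⟨x, x'⟩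
y'⟩`. Hence `⟨v(x o), v(x' o')⟩ = ⟨v(o), v(⟨x, x'⟩ o')⟩`, first for products and then by density in
general (`isCovariantFamily_dilVec`).

This covariance alone produces an isometric representation on the closed span
(`IsCovariantFamily.rep`). It bounds left multiplication, which makes the operators well defined,
and it says that `V_t(x)* V_t(x') = V_0(⟨x, x'⟩)`. The dilation properties are then read off the
formula. Degrees `s_-`, `s_+` are disjoint, so `m = 0` gives regularity. Degree `0` is disjoint from
every degree, so the adjoint of the embedding sends `v(o, h)` to `o h`; it therefore intertwines
`V_s(x)` with `T_s(x)`, and this gives both the reduction of `V_0(A)` by `H` and the vanishing of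
`P_H V_s(x)` on the complement of `H`. -/

noncomputable section

namespace ProductSystemDilation

/-! ### Completing squares in a non-unital C⋆-algebra -/

section CStarFacts

variable {B : Type*} [NonUnitalCStarAlgebra B] [PartialOrder B] [StarOrderedRing B]

/-- For `0 ≤ R` with `‖R‖ ≤ s²`, the element `s² - R` of the unitization is the square of `s - c`
for some selfadjoint `c`. -/
lemma exists_isSelfAdjoint_sub_mul_self_eq {R : B} (hR : 0 ≤ R) {s : ℝ} (hs : 0 ≤ s)
    (hRs : ‖R‖ ≤ s ^ 2) :
    ∃ c : B, IsSelfAdjoint c ∧ (s : ℂ) • c + (s : ℂ) • c - c * c = R := by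
  have hsa : IsSelfAdjoint R := .of_nonneg hR
  -- The function solves `(s - f t)² = s² - t`. As `f 0 = 0`, the non-unital calculus applies and `c
  -- = f(R)` stays in `B`.
  set f : ℝ → ℝ := fun t => s - √(s ^ 2 - t) with hf
  have hfc : Continuous f := by fun_prop
  have hf0 : f 0 = 0 := by simp [hf, Real.sqrt_sq hs]
  refine ⟨cfcₙ f R, cfcₙ_predicate _ _, ?_⟩
  have h1 : cfcₙ (fun x : ℝ => x) R = R := cfcₙ_id' ℝ R
  have h2 : (s : ℂ) • cfcₙ f R = cfcₙ (fun t => s * f t) R := by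
    rw [cfcₙ_const_mul s f R (by fun_prop) hf0]
    exact RCLike.real_smul_eq_coe_smul (K := ℂ) s (cfcₙ f R) |>.symm
  rw [h2, ← cfcₙ_mul f f R (by fun_prop) hf0 (by fun_prop) hf0,
    ← cfcₙ_add (fun t => s * f t) (fun t => s * f t) R (by fun_prop) (by simp [hf0])
      (by fun_prop) (by simp [hf0]),
    ← cfcₙ_sub (fun t => s * f t + s * f t) (fun t => f t * f t) R (by fun_prop) (by simp [hf0])
      (by fun_prop) (by simp [hf0])]
  conv_rhs => rw [← h1]
  refine cfcₙ_congr fun x hx => ?_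
  -- On the spectrum `x ≤ ‖R‖ ≤ s²`, so the square root is a genuine one and not the default value
  -- `0`.
  have h3 : ‖x‖ ≤ ‖R‖ :=
    NonUnitalIsometricContinuousFunctionalCalculus.norm_quasispectrum_le R hx hsa
  have h4 : x ≤ s ^ 2 := (le_abs_self x).trans (h3.trans hRs)
  have h5 := Real.mul_self_sqrt (sub_nonneg.2 h4)
  simp only [hf]
  nlinarith

end CStarFacts

/-! ### Norm bounds for the left action and for isometric maps -/

section Correspondences

open Correspondence

variable {A : Type uA} [NonUnitalCStarAlgebra A] [PartialOrder A] [StarOrderedRing A]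
variable {E : Type uE} [NormedAddCommGroup E] [NormedSpace ℂ E] [Correspondence A E]

/-- Write `a* a = 2‖a‖c - c²` with `c` selfadjoint. Then `‖a‖²⟨x, x⟩ - ⟨ax, ax⟩` is the inner square
of `‖a‖x - cx`, hence positive; no unit of `A` enters. -/
lemma norm_lact_le (a : A) (x : E) : ‖lact a x‖ ≤ ‖a‖ * ‖x‖ := by
  obtain ⟨c, hc, hca⟩ := exists_isSelfAdjoint_sub_mul_self_eq (star_mul_self_nonneg a)
    (norm_nonneg a) (by rw [CStarRing.norm_star_mul_self, sq])
  have h1 : ip (A := A) ((‖a‖ : ℂ) • x - lact c x) ((‖a‖ : ℂ) • x - lact c x) =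
      ((‖a‖ : ℂ) ^ 2) • ip x x - ip (lact a x) (lact a x) := by
    rw [ip_lact_left a, ← lact_mul, ← hca]
    simp only [ip_sub_left, ip_sub_right, ip_smul_left, ip_smul_right, map_sub, map_add, map_smul,
      LinearMap.sub_apply, LinearMap.add_apply, LinearMap.smul_apply, ip_add_right, lact_mul]
    rw [ip_lact_left c x x, ip_lact_left c x (lact c x), hc.star_eq]
    simp only [smul_sub, smul_smul, sq, Complex.star_def, Complex.conj_ofReal]
    abel
  have h2 : ip (A := A) (lact a x) (lact a x) ≤ ((‖a‖ : ℂ) ^ 2) • ip x x :=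
    sub_nonneg.1 (h1 ▸ ip_self_nonneg _)
  have h3 := CStarAlgebra.norm_le_norm_of_nonneg_of_le (ip_self_nonneg (A := A) (lact a x)) h2
  refine le_of_sq_le_sq ?_ (by positivity)
  rw [norm_sq_eq (A := A), mul_pow, norm_sq_eq (A := A) x]
  simpa [norm_smul] using h3

variable {H : Type uH} [NormedAddCommGroup H] [InnerProductSpace ℂ H] [CompleteSpace H]

/-- A map with `T(x)* T(y) = σ(⟨x, y⟩)` is completely contractive. -/
lemma isCompletelyContractive_of_isometric (σ : A →⋆ₙₐ[ℂ] (H →L[ℂ] H)) {T : E →ₗ[ℂ] (H →L[ℂ] H)}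
    (hT : ∀ x y, (T x)† ∘L T y = σ (ip x y)) : IsCompletelyContractive A T := by
  intro n x h
  set M : CStarMatrix (Fin n) (Fin n) A :=
    CStarMatrix.ofMatrix (Matrix.of fun i j => ∑ k, ip (A := A) (x k i) (x k j)) with hM
  have hMij : ∀ i j, M i j = ∑ k, ip (A := A) (x k i) (x k j) := fun _ _ => rfl
  -- `M` is the sum of the Gram matrices of the rows of `x`, which makes it positive.
  have hM' : M = ∑ k, gram (x k) := by
    ext i j
    rw [hMij]
    have : ∀ s : Finset (Fin n), (∑ k ∈ s, gram (A := A) (x k)) i j =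
        ∑ k ∈ s, ip (A := A) (x k i) (x k j) := by
      intro s
      induction s using Finset.cons_induction with
      | empty => simp
      | cons a s ha ih => rw [Finset.sum_cons, Finset.sum_cons, CStarMatrix.add_apply, ih,
          gram_apply]
    rw [this]
  have hM0 : 0 ≤ M := hM' ▸ Finset.sum_nonneg fun k _ => gram_nonneg _
  have hmat : matNorm A x = √‖M‖ := rfl
  rw [hmat]
  set s := √‖M‖ with hs
  obtain ⟨c, hc, hcM⟩ := exists_isSelfAdjoint_sub_mul_self_eq hM0 (Real.sqrt_nonneg ‖M‖)
    (Real.sq_sqrt (norm_nonneg M)).ge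
  rw [← hs] at hcM
  have hcij : ∀ i j, star (c i j) = c j i := fun i j => by
    have := congrFun (congrFun hc j) i
    rwa [CStarMatrix.star_apply] at this
  have hMc : ∀ i j, M i j = (s : ℂ) • c i j + (s : ℂ) • c i j - ∑ k, star (c k i) * c k j := by
    intro i j
    rw [← hcM]
    simp only [CStarMatrix.sub_apply, CStarMatrix.add_apply, CStarMatrix.smul_apply,
      CStarMatrix.mul_apply, hcij]
  -- The quadratic form of `σ(M)` at `h` is the quantity to be bounded. Substituting `M = 2sc - c*c`
  -- with `s² = ‖M‖`, it equals `s²‖h‖² - ‖s h - g‖²`, where `g = σ(c) h` is computed entrywise.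
  have e1 : ∑ i, ∑ j, ⟪h i, σ (M i j) (h j)⟫_ℂ =
      ((∑ i, ‖∑ j, T (x i j) (h j)‖ ^ 2 : ℝ) : ℂ) := by
    have h1 : ∀ k, ((‖∑ j, T (x k j) (h j)‖ ^ 2 : ℝ) : ℂ) =
        ∑ i, ∑ j, ⟪h i, σ (ip (x k i) (x k j)) (h j)⟫_ℂ := by
      intro k
      have := inner_self_eq_norm_sq_to_K (𝕜 := ℂ) (∑ j, T (x k j) (h j))
      push_cast
      rw [← Complex.coe_algebraMap, ← this, sum_inner]
      refine Finset.sum_congr rfl fun i _ => ?_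
      rw [inner_sum]
      refine Finset.sum_congr rfl fun j _ => ?_
      rw [← hT, ContinuousLinearMap.comp_apply, ContinuousLinearMap.adjoint_inner_right]
    rw [Complex.ofReal_sum]
    simp only [h1, hMij, map_sum, sum_apply, inner_sum]
    rw [Finset.sum_comm (s := Finset.univ (α := Fin n))]
    symm
    rw [Finset.sum_comm]
    conv_rhs => rw [Finset.sum_comm]
    refine Finset.sum_congr rfl fun i _ => ?_
    rw [Finset.sum_comm]
  have e2 : ∑ i, ∑ j, ⟪h i, σ (∑ k, star (c k i) * c k j) (h j)⟫_ℂ =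
      ((∑ k, ‖∑ j, σ (c k j) (h j)‖ ^ 2 : ℝ) : ℂ) := sum_inner_eq σ (d := c) (fun _ _ => rfl) h
  set g : Fin n → H := fun k => ∑ j, σ (c k j) (h j) with hg
  have e3 : ∑ i, ∑ j, ⟪h i, σ (M i j) (h j)⟫_ℂ =
      (s : ℂ) * ∑ i, ⟪h i, g i⟫_ℂ + (s : ℂ) * ∑ i, ⟪h i, g i⟫_ℂ -
        ((∑ k, ‖g k‖ ^ 2 : ℝ) : ℂ) := by
    rw [← e2]
    simp only [hg, inner_sum, Finset.mul_sum, ← Finset.sum_add_distrib, ← Finset.sum_sub_distrib]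
    refine Finset.sum_congr rfl fun i _ => Finset.sum_congr rfl fun j _ => ?_
    rw [hMc]
    simp only [map_sub, map_add, map_smul, sub_apply, add_apply, smul_apply, inner_sub_right,
      inner_add_right, inner_smul_right]
  have e4 := congrArg Complex.re (e1.symm.trans e3)
  have e5 : ∀ i, ‖(s : ℂ) • h i - g i‖ ^ 2 =
      s ^ 2 * ‖h i‖ ^ 2 - 2 * (s * (⟪h i, g i⟫_ℂ).re) + ‖g i‖ ^ 2 := by
    intro i
    rw [norm_sub_sq (𝕜 := ℂ), norm_smul, mul_pow, inner_smul_left]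
    simp
  have e6 : 0 ≤ ∑ i, ‖(s : ℂ) • h i - g i‖ ^ 2 := by positivity
  simp only [e5, Finset.sum_add_distrib, Finset.sum_sub_distrib, ← Finset.mul_sum] at e6
  simp only [Complex.sub_re, Complex.add_re, Complex.ofReal_re, Complex.re_ofReal_mul,
    Complex.re_sum] at e4
  linarith

end Correspondences

/-! ### Adjoints of multiplicative maps -/

section StarMaps

variable {A : Type uA} [NonUnitalCStarAlgebra A]
variable {H : Type uH} [NormedAddCommGroup H] [InnerProductSpace ℂ H] [CompleteSpace H]

/-- A map with `W(a)* W(b) = W(a* b)` preserves adjoints. -/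
lemma map_star_of_adjoint_comp {W : A → H →L[ℂ] H} (hW : ∀ a b, (W a)† ∘L W b = W (star a * b))
    (hmul : ∀ a b, W (a * b) = W a ∘L W b) (a : A) : W (star a) = (W a)† := by
  have hW' : ∀ a b k, ((W a)†) (W b k) = W (star a) (W b k) := fun a b k => by
    rw [← ContinuousLinearMap.comp_apply, hW, hmul]; rfl
  -- A vector orthogonal to all ranges is killed by all `W b`, since `‖W b k‖² = ⟨k, W(b* b) k⟩ =
  -- ⟨W(b* b)* k, k⟩ = 0`.
  have h0 : ∀ k, (∀ b, ((W b)†) k = 0) → ∀ b, W b k = 0 := by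
    intro k hk b
    rw [← inner_self_eq_zero (𝕜 := ℂ), ← ContinuousLinearMap.adjoint_inner_right,
      ← ContinuousLinearMap.comp_apply, hW, ← ContinuousLinearMap.adjoint_inner_left, hk,
      inner_zero_left]
  ext ξ
  -- `N = W(a*)* - W(a)` satisfies `W(b)* N = 0` for all `b`, whence `N* N = 0`
  have h1 : ∀ ζ, ((W (star a))†) ζ - W a ζ = 0 := by
    intro ζ
    set k := ((W (star a))†) ζ - W a ζ with hk
    have h2 : ∀ b, ((W b)†) k = 0 := by
      intro b
      refine ext_inner_right ℂ fun v => ?_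
      rw [ContinuousLinearMap.adjoint_inner_left, hk, inner_sub_left,
        ContinuousLinearMap.adjoint_inner_left, ← ContinuousLinearMap.adjoint_inner_right (W a),
        hW', inner_zero_left, sub_self]
    have h3 := h0 k h2
    rw [← inner_self_eq_zero (𝕜 := ℂ)]
    nth_rewrite 1 [hk]
    rw [inner_sub_left, ContinuousLinearMap.adjoint_inner_left,
      ← ContinuousLinearMap.adjoint_inner_right (W a), h3, h2]
    simp
  have h4 : (W (star a))† = W a := by
    ext ζ; exact sub_eq_zero.1 (h1 ζ)
  rw [← h4, ContinuousLinearMap.adjoint_adjoint]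

end StarMaps

/-! ### The total space of the product system and the generating vectors of `𝓗` -/

section Generators

open Correspondence ProductSystem

variable {A : Type uA} [NonUnitalCStarAlgebra A] [PartialOrder A] [StarOrderedRing A]
  {S : Type uΩ} [AddCommMonoid S] {X : S → Type uX} [∀ s, NormedAddCommGroup (X s)]
  [∀ s, NormedSpace ℂ (X s)] [∀ s, Correspondence A (X s)] [ProductSystem A X]
  {H : Type uH} [NormedAddCommGroup H] [InnerProductSpace ℂ H] [CompleteSpace H]

variable (A) in
/-- The multiplication of the total space of a product system. -/
def totalMul (p r : Σ s, X s) : Σ s, X s := ⟨p.1 + r.1, mul (A := A) p.2 r.2⟩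

lemma totalMul_assoc (p r q : Σ s, X s) :
    totalMul A (totalMul A p r) q = totalMul A p (totalMul A r q) :=
  mul_assoc p.2 r.2 q.2

variable (A) in
/-- The action of the total space on itself with a unit `none` adjoined. -/
def act (p : Σ s, X s) : Option (Σ s, X s) → Option (Σ s, X s)
  | none => some p
  | some r => some (totalMul A p r)

lemma act_act (p r : Σ s, X s) (o : Option (Σ s, X s)) :
    act A p (act A r o) = act A (totalMul A p r) o := by
  cases o with
  | none => rfl
  | some q => exact congrArg some (totalMul_assoc p r q).symm

variable (X) in
/-- The copy of `a ∈ A` in the total space. -/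
def totalUnit (a : A) : Σ s, X s := ⟨0, unit (A := A) (X := X) a⟩

lemma totalUnit_mul (a : A) {s : S} (x : X s) : totalMul A (totalUnit X a) ⟨s, x⟩ = ⟨s, lact a x⟩ :=
  unit_mul a x

lemma mul_totalUnit (a : A) {s : S} (x : X s) : totalMul A ⟨s, x⟩ (totalUnit X a) = ⟨s, ract x a⟩ :=
  mul_unit x a

lemma totalUnit_mul_totalUnit (a b : A) :
    totalMul A (totalUnit X a) (totalUnit X b) = totalUnit X (a * b) :=
  (totalUnit_mul a _).trans (congrArg (Sigma.mk 0) (lact_unit a b))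

/-- The degree of an element of the total space with a unit adjoined. -/
def deg : Option (Σ s, X s) → S
  | none => 0
  | some p => p.1

lemma deg_act (p : Σ s, X s) (o : Option (Σ s, X s)) : deg (act A p o) = p.1 + deg o := by
  cases o with
  | none => exact (add_zero _).symm
  | some r => rfl

variable (A) in
-- With `⟨x, x⟩ = d* d` one has `⟨xy, xy⟩ = ⟨y, ⟨x, x⟩ y⟩ = ⟨dy, dy⟩` and `‖d‖ = ‖x‖`, so the bound
-- for the left action applies.
lemma norm_mul_le_of_ne_zero {s t : S} (hs : s ≠ 0) (ht : t ≠ 0) (x : X s) (y : X t) :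
    ‖(mul (A := A) x y : X (s + t))‖ ≤ ‖x‖ * ‖y‖ := by
  obtain ⟨d, hd, -⟩ := exists_sqrt_approx (ip (A := A) x x) (ip_self_nonneg x)
  have h1 : ‖(mul (A := A) x y : X (s + t))‖ ^ 2 = ‖lact d y‖ ^ 2 := by
    rw [norm_sq_eq (A := A), norm_sq_eq (A := A), ip_mul hs ht, ip_lact_left, ← lact_mul, hd]
  have h2 : ‖d‖ ^ 2 = ‖x‖ ^ 2 := by
    rw [norm_sq_eq (A := A) x, ← hd, CStarRing.norm_star_mul_self, sq]
  rw [(sq_eq_sq₀ (norm_nonneg _) (norm_nonneg _)).1 h1,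
    ← (sq_eq_sq₀ (norm_nonneg _) (norm_nonneg _)).1 h2]
  exact norm_lact_le d y

/-- Two functions on the elements of degree `m + p`, `m ≠ 0`, that are linear and continuous on
fibres agree if they agree on the products of elements of degrees `m` and `p`. -/
lemma eq_of_eq_on_act {m p : S} (hm : m ≠ 0) {f g : Option (Σ s, X s) → ℂ}
    (hf : ∀ s ≠ 0, ∃ F : X s →L[ℂ] ℂ, ∀ y, f (some ⟨s, y⟩) = F y)
    (hg : ∀ s ≠ 0, ∃ G : X s →L[ℂ] ℂ, ∀ y, g (some ⟨s, y⟩) = G y)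
    (hfg : ∀ (y : X m) (o : Option (Σ s, X s)), deg o = p →
      f (act A ⟨m, y⟩ o) = g (act A ⟨m, y⟩ o))
    (hmp : m + p ≠ 0) (o : Option (Σ s, X s)) (ho : deg o = m + p) : f o = g o := by
  obtain _ | ⟨s, y⟩ := o
  · exact absurd ho.symm hmp
  change s = m + p at ho
  -- If `p = 0`, an element of degree `m` is itself acting on the formal unit `none`. Otherwise the
  -- products are total in `X (m + p)`.
  by_cases hp : p = 0
  · subst hp
    rw [add_zero] at ho
    subst ho
    exact hfg y none rfl
  subst ho
  obtain ⟨F, hF⟩ := hf _ hmp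
  obtain ⟨G, hG⟩ := hg _ hmp
  rw [hF, hG]
  refine DFunLike.congr_fun (ContinuousLinearMap.ext_on (dense_mul (A := A) hm hp) ?_) y
  rintro _ ⟨x, z, rfl⟩
  rw [← hF, ← hG]
  exact hfg x (some ⟨p, z⟩) rfl

/-- The inner product `⟨x y, x' y'⟩ = ⟨y, ⟨x, x'⟩ y'⟩`, for factors `x, x'` of any degree. -/
lemma exists_totalMul_eq {t m : S} (hm : m ≠ 0) (x x' : X t) (y y' : X m) :
    ∃ (r : S) (z z' : X r), totalMul A ⟨t, x⟩ ⟨m, y⟩ = ⟨r, z⟩ ∧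
      totalMul A ⟨t, x'⟩ ⟨m, y'⟩ = ⟨r, z'⟩ ∧ ip (A := A) z z' = ip y
      (lact (ip (A := A) x x') y') := by
  -- For `t = 0` both products are left actions and lie in `X m` itself. The existential fibre `r`
  -- covers this case together with `t + m` without transport along `0 + m = m`.
  by_cases ht : t = 0
  · subst ht
    obtain ⟨a, rfl⟩ := (unit (A := A) (X := X)).surjective x
    obtain ⟨b, rfl⟩ := (unit (A := A) (X := X)).surjective x'
    refine ⟨m, lact a y, lact b y', totalUnit_mul a y, totalUnit_mul b y', ?_⟩
    rw [ip_unit, ip_lact_left, lact_mul]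
  · exact ⟨t + m, mul (A := A) x y, mul (A := A) x' y', rfl, rfl, ip_mul ht hm _ _ _ _⟩

variable (A) in
lemma exists_totalMul_eq_clm {t s : S} (hs : s ≠ 0) (x : X t) :
    ∃ (r : S) (F : X s →L[ℂ] X r), ∀ y, totalMul A ⟨t, x⟩ ⟨s, y⟩ = ⟨r, F y⟩ := by
  by_cases ht : t = 0
  · subst ht
    obtain ⟨a, rfl⟩ := (unit (A := A) (X := X)).surjective x
    exact ⟨s, (lact a).mkContinuous ‖a‖ (norm_lact_le a), totalUnit_mul a⟩
  · exact ⟨t + s, (mul (A := A) x).mkContinuous ‖x‖ (norm_mul_le_of_ne_zero A ht hs x),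
      fun _ => rfl⟩

namespace Representation

variable (π : Representation A X H)

/-- The operator by which an element of the total space with a unit adjoined acts on `H`. -/
def val : Option (Σ s, X s) → H →L[ℂ] H
  | none => ContinuousLinearMap.id ℂ H
  | some p => π.T p.1 p.2

lemma val_act (p : Σ s, X s) (o : Option (Σ s, X s)) :
    π.val (act A p o) = π.T p.1 p.2 ∘L π.val o := by
  cases o with
  | none => rfl
  | some r => exact π.T_mul p.1 r.1 p.2 r.2

lemma val_act_totalUnit (a : A) (o : Option (Σ s, X s)) :
    π.val (act A (totalUnit X a) o) = π.σ a ∘L π.val o := by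
  rw [val_act, ← π.T_unit]; rfl

/-- The tensor product is balanced because the semi-inner product already is: both sides pair
equally with elementary tensors, so their difference has norm zero. -/
lemma tmul_ract {s : S} (x : X s) (a : A) (h : H) :
    tmul π.σ (ract x a) h = tmul π.σ x (π.σ a h) := by
  have h1 : ∀ (y : X s) (g : H), ⟪tmul π.σ y g, tmul π.σ (ract x a) h⟫_ℂ =
      ⟪tmul π.σ y g, tmul π.σ x (π.σ a h)⟫_ℂ := by
    intro y g
    rw [inner_tmul_tmul, inner_tmul_tmul, ip_ract_right, map_mul]; rfl
  rw [← sub_eq_zero, ← inner_self_eq_zero (𝕜 := ℂ)]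
  simp only [inner_sub_left, inner_sub_right]
  rw [h1, h1]; simp

variable [IsCancelAdd S] [Subsingleton (AddUnits S)]

/-- The vector `δ_0 · h`. -/
def inl : H →ₗᵢ[ℂ] π.HatSpace where
  toFun h := WithLp.toLp 2 (h, 0)
  map_add' h g := by apply WithLp.ofLp_injective; simp
  map_smul' c h := by apply WithLp.ofLp_injective; simp
  norm_map' h := by simp

open Classical in
/-- The vector `δ_s · ξ`, for `s ≠ 0`. -/
def inr (s : {s : S // s ≠ 0}) : InteriorTensor π.σ (X s) →ₗᵢ[ℂ] π.HatSpace where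
  toFun ξ := WithLp.toLp 2 (0, lp.single 2 s ξ)
  map_add' h g := by apply WithLp.ofLp_injective; simp [lp.single_add]
  map_smul' c h := by apply WithLp.ofLp_injective; simp [lp.single_smul]
  norm_map' h := by simp [lp.norm_single]

open Classical in
/-- The vector of `𝓗` defined by an element of the total space with a unit adjoined and `h ∈ H`:
`δ_0 · h`, resp. `δ_s · (x ⊗ h)` for `x ∈ X(s)`, `s ≠ 0`, and `δ_0 · σ(a) h` for `a ∈ A`. -/
def hatVec : Option (Σ s, X s) → H → π.HatSpace
  | none, h => π.inl h
  | some p, h => if hp : p.1 = 0 then π.inl (π.T p.1 p.2 h) else π.inr ⟨p.1, hp⟩ (tmul π.σ p.2 h)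

lemma hatVec_some_zero (y : X (0 : S)) (h : H) :
    π.hatVec (some ⟨0, y⟩) h = π.inl (π.T 0 y h) := dif_pos rfl

lemma hatVec_some {s : S} (hs : s ≠ 0) (y : X s) (h : H) :
    π.hatVec (some ⟨s, y⟩) h = π.inr ⟨s, hs⟩ (tmul π.σ y h) := dif_neg hs

lemma inr_snd_self (s : {s : S // s ≠ 0}) (ξ : InteriorTensor π.σ (X s)) :
    (π.inr s ξ).snd s = ξ := by
  classical exact lp.single_apply_self (E := fun s : {s : S // s ≠ 0} =>
    InteriorTensor π.σ (X s)) 2 s ξ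

lemma inr_snd_of_ne {s u : {s : S // s ≠ 0}} (h : u ≠ s) (ξ : InteriorTensor π.σ (X s)) :
    (π.inr s ξ).snd u = 0 := by
  classical exact lp.single_apply_ne (E := fun s : {s : S // s ≠ 0} =>
    InteriorTensor π.σ (X s)) 2 s ξ h

lemma hat_inr_self (s : {s : S // s ≠ 0}) (ξ : InteriorTensor π.σ (X s)) :
    π.hat s (π.inr s ξ) = π.inl (π.tilde s ξ) := by
  apply WithLp.ofLp_injective
  refine Prod.ext ?_ ?_
  · change (π.hat s _).fst = π.tilde s ξ
    rw [hat_fst π s.2, inr_snd_self]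
  · change (π.hat s _).snd = 0
    ext u : 2
    rw [hat_snd π s.2, inr_snd_of_ne, map_zero]
    · rfl
    · intro h
      have h' : u.1 + s = s := congrArg Subtype.val h
      exact u.2 (by simpa using h')

lemma hat_inr_add {m s : S} (hm : m ≠ 0) (hs : s ≠ 0) (hms : m + s ≠ 0)
    (ξ : InteriorTensor π.σ (X (m + s))) :
    π.hat s (π.inr ⟨m + s, hms⟩ ξ) = π.inr ⟨m, hm⟩ (π.block m s ξ) := by
  apply WithLp.ofLp_injective
  refine Prod.ext ?_ ?_
  · change (π.hat s _).fst = 0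
    rw [hat_fst π hs, inr_snd_of_ne, map_zero]
    intro h
    have h' : s = m + s := congrArg Subtype.val h
    exact hm (by simpa using h'.symm)
  · change (π.hat s _).snd = (π.inr ⟨m, hm⟩ (π.block m s ξ)).snd
    ext u : 2
    rw [hat_snd π hs]
    obtain ⟨u, hu⟩ := u
    by_cases hum : u = m
    · subst hum
      rw [inr_snd_self, inr_snd_self]
    · rw [inr_snd_of_ne, inr_snd_of_ne, map_zero]
      · exact fun h => hum (congrArg Subtype.val h)
      · exact fun h => hum (add_right_cancel (congrArg Subtype.val h))

/-- `T̂` taken at the full degree of a generating vector carries it into the summand `H`. This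
computes inner products of generating vectors of disjoint degrees. -/
lemma hat_hatVec (o : Option (Σ s, X s)) (h : H) :
    π.hat (deg o) (π.hatVec o h) = π.inl (π.val o h) := by
  obtain _ | ⟨s, y⟩ := o
  · change π.hat 0 _ = _
    rw [hat_zero]; rfl
  change π.hat s _ = π.inl (π.T s y h)
  by_cases hs : s = 0
  · subst hs
    rw [hat_zero, hatVec_some_zero]; rfl
  · rw [hatVec_some π hs, hat_inr_self π ⟨s, hs⟩, tilde_tmul]

/-- `T̂` at the degree of the right factor absorbs that factor into `H` and leaves `y` in place. A
right factor of degree `0` is not moved by `T̂_0 = I`; there balancedness of the tensor product does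
the work. -/
lemma hat_hatVec_act {m : S} (hm : m ≠ 0) (y : X m) (o : Option (Σ s, X s)) (h : H) :
    π.hat (deg o) (π.hatVec (act A ⟨m, y⟩ o) h) = π.inr ⟨m, hm⟩ (tmul π.σ y (π.val o h)) := by
  obtain _ | ⟨s, z⟩ := o
  · change π.hat 0 (π.hatVec (some ⟨m, y⟩) h) = _
    rw [hat_zero, hatVec_some π hm]; rfl
  by_cases hs : s = 0
  · subst hs
    obtain ⟨a, rfl⟩ := (unit (A := A) (X := X)).surjective z
    change π.hat 0 (π.hatVec (some (totalMul A ⟨m, y⟩ (totalUnit X a))) h) =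
      π.inr ⟨m, hm⟩ (tmul π.σ y (π.T 0 (unit (A := A) a) h))
    rw [hat_zero, mul_totalUnit, hatVec_some π hm, tmul_ract, π.T_unit]; rfl
  · have hms : m + s ≠ 0 := add_ne_zero_of_left hm
    change π.hat s (π.hatVec (some ⟨m + s, mul (A := A) y z⟩) h) =
      π.inr ⟨m, hm⟩ (tmul π.σ y (π.T s z h))
    rw [hatVec_some π hms, hat_inr_add π hm hs, block_tmul π hm hs]

/-- `hatVec` as a continuous linear map on fibres. -/
def hatVecCLM (s : S) (h : H) : X s →L[ℂ] π.HatSpace :=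
  LinearMap.mkContinuous
    { toFun y := π.hatVec (some ⟨s, y⟩) h
      map_add' y z := by
        by_cases hs : s = 0
        · subst hs; simp [hatVec_some_zero]
        · simp [hatVec_some π hs, tmul, TensorProduct.add_tmul]
      map_smul' c y := by
        by_cases hs : s = 0
        · subst hs; simp [hatVec_some_zero]
        · simp [hatVec_some π hs, tmul, ← TensorProduct.smul_tmul'] } ‖h‖ fun y => by
    rw [mul_comm]
    by_cases hs : s = 0
    · subst hs
      change ‖π.hatVec _ h‖ ≤ _
      rw [hatVec_some_zero, LinearIsometry.norm_map]
      exact norm_le_of_cc (π.completelyContractive 0) y h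
    · change ‖π.hatVec _ h‖ ≤ _
      rw [hatVec_some π hs, LinearIsometry.norm_map]
      exact norm_tmul_le _ y h

end Representation

end Generators

/-! ### The isometric representation generated by a covariant family -/

section CovariantFamilies

open Correspondence ProductSystem

variable {A : Type uA} [NonUnitalCStarAlgebra A] [PartialOrder A] [StarOrderedRing A]
  {S : Type uΩ} [AddCommMonoid S] {X : S → Type uX} [∀ s, NormedAddCommGroup (X s)]
  [∀ s, NormedSpace ℂ (X s)] [∀ s, Correspondence A (X s)] [ProductSystem A X]
  {I : Type uH} {K : Type uK} [NormedAddCommGroup K] [InnerProductSpace ℂ K]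

variable (A) in
/-- A family of vectors indexed by `((Σ s, X s) ∪ {1}) × I`, linear on the fibres `X s`, such that
`⟨v(x o), v(x' o')⟩ = ⟨v(o), v(⟨x, x'⟩ o')⟩` for `x, x'` in the same fibre. -/
structure IsCovariantFamily (v : Option (Σ s, X s) → I → K) : Prop where
  map_add : ∀ {s : S} (x y : X s) (i : I),
    v (some ⟨s, x + y⟩) i = v (some ⟨s, x⟩) i + v (some ⟨s, y⟩) i
  map_smul : ∀ {s : S} (c : ℂ) (x : X s) (i : I), v (some ⟨s, c • x⟩) i = c • v (some ⟨s, x⟩) i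
  inner_act : ∀ {t : S} (x x' : X t) (o o' : Option (Σ s, X s)) (i i' : I),
    ⟪v (act A ⟨t, x⟩ o) i, v (act A ⟨t, x'⟩ o') i'⟫_ℂ =
      ⟪v o i, v (act A (totalUnit X (ip (A := A) x x')) o') i'⟫_ℂ

/-- The closed linear span of a family of vectors. -/
abbrev familySpan (v : Option (Σ s, X s) → I → K) : Submodule ℂ K :=
  (LinearMap.range (Finsupp.linearCombination ℂ (Function.uncurry v))).topologicalClosure

/-- The map from the free module on the index set onto a dense subspace of the closed span. -/
def ofFree (v : Option (Σ s, X s) → I → K) :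
    (Option (Σ s, X s) × I →₀ ℂ) →ₗ[ℂ] familySpan v :=
  (Finsupp.linearCombination ℂ (Function.uncurry v)).codRestrict _
    fun u => Submodule.le_topologicalClosure _ ⟨u, rfl⟩

variable (A I) in
/-- The action of the total space of the product system on the free module. -/
def freeAct (p : Σ s, X s) :
    (Option (Σ s, X s) × I →₀ ℂ) →ₗ[ℂ] (Option (Σ s, X s) × I →₀ ℂ) :=
  Finsupp.lmapDomain ℂ ℂ fun k => (act A p k.1, k.2)

lemma freeAct_single (p : Σ s, X s) (o : Option (Σ s, X s)) (i : I) (c : ℂ) :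
    freeAct A I p (Finsupp.single (o, i) c) = Finsupp.single (act A p o, i) c := by
  simp [freeAct]

lemma freeAct_freeAct (p r : Σ s, X s) (u : Option (Σ s, X s) × I →₀ ℂ) :
    freeAct A I p (freeAct A I r u) = freeAct A I (totalMul A p r) u := by
  induction u using Finsupp.induction_linear with
  | zero => simp
  | add u w hu hw => simp only [map_add, hu, hw]
  | single k c =>
    obtain ⟨o, i⟩ := k
    rw [freeAct_single, freeAct_single, freeAct_single, act_act]

lemma coe_ofFree_single (v : Option (Σ s, X s) → I → K) (o : Option (Σ s, X s)) (i : I) (c : ℂ) :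
    (ofFree v (Finsupp.single (o, i) c) : K) = c • v o i := by
  simp [ofFree]

lemma denseRange_ofFree (v : Option (Σ s, X s) → I → K) : DenseRange (ofFree v) := by
  intro k
  rw [closure_subtype]
  refine closure_mono ?_ k.2
  rintro _ ⟨u, rfl⟩
  exact ⟨ofFree v u, ⟨u, rfl⟩, rfl⟩

lemma clm_ext_ofFree {v : Option (Σ s, X s) → I → K} {L : Type*} [NormedAddCommGroup L]
    [NormedSpace ℂ L] {F G : familySpan v →L[ℂ] L} (h : ∀ u, F (ofFree v u) = G (ofFree v u)) :
    F = G :=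
  DFunLike.coe_injective ((denseRange_ofFree v).equalizer F.continuous G.continuous (funext h))

/-- The member of the family with the given index, as an element of the closed span. -/
def familyVec (v : Option (Σ s, X s) → I → K) (o : Option (Σ s, X s)) (i : I) : familySpan v :=
  ofFree v (Finsupp.single (o, i) 1)

lemma coe_familyVec (v : Option (Σ s, X s) → I → K) (o : Option (Σ s, X s)) (i : I) :
    (familyVec v o i : K) = v o i := by
  rw [familyVec, coe_ofFree_single, one_smul]

lemma mem_of_familyVec_mem {v : Option (Σ s, X s) → I → K} {M : Submodule ℂ (familySpan v)}
    (hM : IsClosed (M : Set (familySpan v))) (h : ∀ o i, familyVec v o i ∈ M) (k : familySpan v) :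
    k ∈ M := by
  have h1 : ∀ u, ofFree v u ∈ M := by
    intro u
    induction u using Finsupp.induction_linear with
    | zero => simp
    | add u w hu hw => rw [map_add]; exact M.add_mem hu hw
    | single j c =>
      have : Finsupp.single j c = c • Finsupp.single j (1 : ℂ) := by simp
      rw [this, map_smul]
      exact M.smul_mem c (h j.1 j.2)
  have h2 := hM.closure_subset_iff.2 (Set.range_subset_iff.2 h1)
  rw [(denseRange_ofFree v).closure_eq] at h2
  exact h2 (Set.mem_univ k)

namespace IsCovariantFamily

variable {v : Option (Σ s, X s) → I → K}

lemma vec_act_add (hv : IsCovariantFamily A v) {s : S} (x y : X s) (o : Option (Σ s, X s)) (i : I) :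
    v (act A ⟨s, x + y⟩ o) i = v (act A ⟨s, x⟩ o) i + v (act A ⟨s, y⟩ o) i := by
  cases o with
  | none => exact hv.map_add x y i
  | some r =>
    refine Eq.trans ?_ (hv.map_add _ _ i)
    simp [act, totalMul]

lemma vec_act_smul (hv : IsCovariantFamily A v) {s : S} (c : ℂ) (x : X s) (o : Option (Σ s, X s))
    (i : I) :
    v (act A ⟨s, c • x⟩ o) i = c • v (act A ⟨s, x⟩ o) i := by
  cases o with
  | none => exact hv.map_smul c x i
  | some r =>
    refine Eq.trans ?_ (hv.map_smul c _ i)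
    simp [act, totalMul]

lemma ofFree_add (hv : IsCovariantFamily A v) {s : S} (x y : X s) (u : Option (Σ s, X s) × I →₀ ℂ) :
    ofFree v (freeAct A I ⟨s, x + y⟩ u) =
      ofFree v (freeAct A I ⟨s, x⟩ u) + ofFree v (freeAct A I ⟨s, y⟩ u) := by
  induction u using Finsupp.induction_linear with
  | zero => simp
  | add u w hu hw => simp only [_root_.map_add, hu, hw]; abel
  | single k c =>
    obtain ⟨o, i⟩ := k
    ext
    simp only [freeAct_single, Submodule.coe_add, coe_ofFree_single, hv.vec_act_add, smul_add]

lemma ofFree_smul (hv : IsCovariantFamily A v) {s : S} (c : ℂ) (x : X s)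
    (u : Option (Σ s, X s) × I →₀ ℂ) :
    ofFree v (freeAct A I ⟨s, c • x⟩ u) = c • ofFree v (freeAct A I ⟨s, x⟩ u) := by
  induction u using Finsupp.induction_linear with
  | zero => simp
  | add u w hu hw => simp only [_root_.map_add, hu, hw, smul_add]
  | single k d =>
    obtain ⟨o, i⟩ := k
    ext
    simp only [freeAct_single, Submodule.coe_smul, coe_ofFree_single, hv.vec_act_smul,
      smul_comm c d]

lemma inner_ofFree (hv : IsCovariantFamily A v) {t : S} (x x' : X t)
    (u w : Option (Σ s, X s) × I →₀ ℂ) :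
    ⟪ofFree v (freeAct A I ⟨t, x⟩ u), ofFree v (freeAct A I ⟨t, x'⟩ w)⟫_ℂ =
      ⟪ofFree v u, ofFree v (freeAct A I (totalUnit X (ip (A := A) x x')) w)⟫_ℂ := by
  induction u using Finsupp.induction_linear with
  | zero => simp
  | add u u' hu hu' => simp only [_root_.map_add, inner_add_left, hu, hu']
  | single k c =>
    induction w using Finsupp.induction_linear with
    | zero => simp
    | add w w' hw hw' => simp only [_root_.map_add, inner_add_right, hw, hw']
    | single k' c' =>
      obtain ⟨o, i⟩ := k
      obtain ⟨o', i'⟩ := k'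
      simp only [Submodule.coe_inner, freeAct_single, coe_ofFree_single, inner_smul_left,
        inner_smul_right, hv.inner_act]

/-- The square is completed before any representation of `A` is available. Covariance gives `‖b u‖²
= ⟨u, (b* b) u⟩`; applied to `a` and to the selfadjoint `c` with `a* a = 2‖a‖c - c²`, it yields
`‖a‖²‖u‖² - ‖a u‖² = ‖‖a‖u - c u‖²`. -/
lemma norm_ofFree_unit_le (hv : IsCovariantFamily A v) (a : A) (u : Option (Σ s, X s) × I →₀ ℂ) :
    ‖ofFree v (freeAct A I (totalUnit X a) u)‖ ≤ ‖a‖ * ‖ofFree v u‖ := by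
  obtain ⟨c, hc, hca⟩ := exists_isSelfAdjoint_sub_mul_self_eq (star_mul_self_nonneg a)
    (norm_nonneg a) (by rw [CStarRing.norm_star_mul_self, sq])
  have key : ∀ b : A, ⟪ofFree v (freeAct A I (totalUnit X b) u),
      ofFree v (freeAct A I (totalUnit X b) u)⟫_ℂ =
      ⟪ofFree v u, ofFree v (freeAct A I (totalUnit X (star b * b)) u)⟫_ℂ := fun b => by
    rw [← ip_unit (X := X) b b]
    exact hv.inner_ofFree _ _ u u
  let φ : A →ₗ[ℂ] familySpan v :=
    { toFun b := ofFree v (freeAct A I (totalUnit X b) u)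
      map_add' b b' := by
        simp only [totalUnit, _root_.map_add]; exact hv.ofFree_add _ _ u
      map_smul' d b := by
        simp only [totalUnit, _root_.map_smul]; exact hv.ofFree_smul _ _ u }
  have key' : ∀ b : A, ⟪φ b, φ b⟫_ℂ = ⟪ofFree v u, φ (star b * b)⟫_ℂ := key
  change ‖φ a‖ ≤ _
  have h1 : ‖φ a‖ ^ 2 = 2 * (‖a‖ * (⟪ofFree v u, φ c⟫_ℂ).re) - ‖φ c‖ ^ 2 := by
    rw [← inner_self_eq_norm_sq (𝕜 := ℂ) (φ a), ← inner_self_eq_norm_sq (𝕜 := ℂ) (φ c), key', key',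
      ← hca, hc.star_eq]
    simp only [_root_.map_sub, _root_.map_add, _root_.map_smul, inner_sub_right, inner_add_right,
      inner_smul_right, RCLike.re_to_complex, Complex.re_ofReal_mul]
    ring
  have h2 : ‖(‖a‖ : ℂ) • ofFree v u - φ c‖ ^ 2 =
      ‖a‖ ^ 2 * ‖ofFree v u‖ ^ 2 - 2 * (‖a‖ * (⟪ofFree v u, φ c⟫_ℂ).re) + ‖φ c‖ ^ 2 := by
    rw [norm_sub_sq (𝕜 := ℂ), norm_smul, mul_pow, inner_smul_left]
    simp
  refine le_of_sq_le_sq ?_ (by positivity)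
  rw [mul_pow]
  nlinarith [sq_nonneg ‖(‖a‖ : ℂ) • ofFree v u - φ c‖]

/-- By covariance and Cauchy-Schwarz, `‖p u‖² = ⟨u, ⟨p, p⟩ u⟩ ≤ ‖⟨p, p⟩‖ ‖u‖²`. The bound also shows
that linear relations among the vectors are preserved, so that left multiplication descends from the
free module to the span. -/
lemma norm_ofFree_act_le (hv : IsCovariantFamily A v) (p : Σ s, X s)
    (u : Option (Σ s, X s) × I →₀ ℂ) :
    ‖ofFree v (freeAct A I p u)‖ ≤ ‖p.2‖ * ‖ofFree v u‖ := by
  refine le_of_sq_le_sq ?_ (by positivity)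
  rw [← inner_self_eq_norm_sq (𝕜 := ℂ), hv.inner_ofFree p.2 p.2, mul_pow, norm_sq_eq (A := A)]
  refine (RCLike.re_le_norm _).trans ((norm_inner_le_norm _ _).trans ?_)
  have := hv.norm_ofFree_unit_le (ip p.2 p.2) u
  nlinarith [norm_nonneg (ofFree v u)]

variable [CompleteSpace K]

variable (A v) in
/-- The operator on the closed span given by left multiplication with `p`. -/
def op (p : Σ s, X s) : familySpan v →L[ℂ] familySpan v :=
  ((ofFree v).comp (freeAct A I p)).extendOfNorm (ofFree v)

lemma op_ofFree (hv : IsCovariantFamily A v) (p : Σ s, X s) (u : Option (Σ s, X s) × I →₀ ℂ) :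
    op A v p (ofFree v u) = ofFree v (freeAct A I p u) :=
  LinearMap.extendOfNorm_eq (denseRange_ofFree v) ⟨‖p.2‖, hv.norm_ofFree_act_le p⟩ u

lemma op_familyVec (hv : IsCovariantFamily A v) (p : Σ s, X s) (o : Option (Σ s, X s)) (i : I) :
    op A v p (familyVec v o i) = familyVec v (act A p o) i := by
  rw [familyVec, hv.op_ofFree, freeAct_single]; rfl

lemma op_comp (hv : IsCovariantFamily A v) (p r : Σ s, X s) : op A v (totalMul A p r) =
    op A v p ∘L op A v r :=
  clm_ext_ofFree fun u => by
    rw [ContinuousLinearMap.comp_apply, hv.op_ofFree, hv.op_ofFree, hv.op_ofFree, freeAct_freeAct]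

variable (A v) in
/-- The linear maps `X s → B(K)` of the representation on the closed span. -/
def opLin (hv : IsCovariantFamily A v) (s : S) : X s →ₗ[ℂ] (familySpan v →L[ℂ] familySpan v) where
  toFun x := op A v ⟨s, x⟩
  map_add' x y := clm_ext_ofFree fun u => by
    simp only [add_apply, hv.op_ofFree, hv.ofFree_add]
  map_smul' c x := clm_ext_ofFree fun u => by
    simp only [smul_apply, hv.op_ofFree, hv.ofFree_smul, RingHom.id_apply]

/-- This is covariance, tested on the dense image of the free module. -/
lemma adjoint_op_comp_op (hv : IsCovariantFamily A v) {t : S} (x y : X t) :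
    (op A v ⟨t, x⟩)† ∘L op A v ⟨t, y⟩ = op A v (totalUnit X (ip (A := A) x y)) :=
  clm_ext_ofFree fun u => by
    refine (denseRange_ofFree v).eq_of_inner_left ℂ fun w => ?_
    rw [ContinuousLinearMap.comp_apply, ContinuousLinearMap.adjoint_inner_left, hv.op_ofFree,
      hv.op_ofFree, hv.op_ofFree, ← inner_conj_symm, hv.inner_ofFree, inner_conj_symm]

variable (A v) in
/-- The action of `A` on the closed span. -/
def opStarHom (hv : IsCovariantFamily A v) :
    A →⋆ₙₐ[ℂ] (familySpan v →L[ℂ] familySpan v) where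
  toFun a := op A v (totalUnit X a)
  map_zero' := (congrArg (opLin A v hv 0) (_root_.map_zero _)).trans (_root_.map_zero _)
  map_add' a b := (congrArg (opLin A v hv 0) (_root_.map_add _ a b)).trans (_root_.map_add _ _ _)
  map_smul' c a := (congrArg (opLin A v hv 0) (_root_.map_smul _ c a)).trans
    (_root_.map_smul _ _ _)
  map_mul' a b := by rw [← totalUnit_mul_totalUnit]; exact hv.op_comp _ _
  map_star' a := by
    -- Covariance compares two multiplied vectors, whereas `⟨a u, w⟩` has an unmultiplied `w`, which
    -- may involve the formal unit. The adjoint relation is therefore deduced from the relations for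
    -- `W(a)* W(b)` and `W(ab)`.
    refine map_star_of_adjoint_comp (W := fun a => op A v (totalUnit X a)) (fun a b => ?_)
      (fun a b => ?_) a
    · rw [← ip_unit (X := X) a b]
      exact hv.adjoint_op_comp_op _ _
    · change op A v _ = _
      rw [← totalUnit_mul_totalUnit]; exact hv.op_comp _ _

variable (A v) in
/-- The isometric representation on the closed span of a covariant family. -/
def rep (hv : IsCovariantFamily A v) : Representation A X (familySpan v) where
  σ := opStarHom A v hv
  T := opLin A v hv
  T_unit _ := rfl
  completelyContractive s := isCompletelyContractive_of_isometric (opStarHom A v hv)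
    fun x y => hv.adjoint_op_comp_op x y
  T_ract s x a := by
    change op A v ⟨s, ract x a⟩ = op A v ⟨s, x⟩ ∘L op A v (totalUnit X a)
    rw [← hv.op_comp, mul_totalUnit]
  T_lact s a x := by
    change op A v ⟨s, lact a x⟩ = op A v (totalUnit X a) ∘L op A v ⟨s, x⟩
    rw [← hv.op_comp, totalUnit_mul]
  T_mul s t x y := hv.op_comp ⟨s, x⟩ ⟨t, y⟩

lemma rep_isIsometric (hv : IsCovariantFamily A v) : (rep A v hv).IsIsometric :=
    fun _ x y => hv.adjoint_op_comp_op x y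

lemma rep_T_familyVec (hv : IsCovariantFamily A v) (s : S) (x : X s) (o : Option (Σ s, X s))
    (i : I) :
    (rep A v hv).T s x (familyVec v o i) = familyVec v (act A ⟨s, x⟩ o) i :=
  hv.op_familyVec _ o i

lemma rep_σ_familyVec (hv : IsCovariantFamily A v) (a : A) (o : Option (Σ s, X s)) (i : I) :
    (rep A v hv).σ a (familyVec v o i) = familyVec v (act A (totalUnit X a) o) i :=
  hv.op_familyVec _ o i

end IsCovariantFamily

end CovariantFamilies

/-! ### Disjoint supports in the index semigroup -/

section Indices

variable {Ω : Type uΩ} {S : Ω → AddSubmonoid ℝ≥0}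

/-- Two elements of `𝓢` have disjoint supports. -/
def DisjSupp (p q : sumSemigroup S) : Prop :=
  ∀ j, (p : Ω →₀ ℝ≥0) j = 0 ∨ (q : Ω →₀ ℝ≥0) j = 0

/-- Take for `m` the pointwise minimum, whose values are values of `s` or of `t` and hence
admissible. Commensurability puts `s - m` and `t - m` in the semigroup, and at each point one of
them vanishes. -/
lemma exists_add_disjSupp (hS : ∀ i, IsCommensurable (S i)) (s t : sumSemigroup S) :
    ∃ m p q : sumSemigroup S, s = m + p ∧ t = m + q ∧ DisjSupp p q := by
  let m : sumSemigroup S := ⟨s ⊓ t, fun j => by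
    rcases le_total ((s : Ω →₀ ℝ≥0) j) ((t : Ω →₀ ℝ≥0) j) with h | h
    · simpa [h] using s.2 j
    · simpa [h] using t.2 j⟩
  have hm : ∀ j, (m : Ω →₀ ℝ≥0) j = (s : Ω →₀ ℝ≥0) j ⊓ (t : Ω →₀ ℝ≥0) j := fun j => rfl
  obtain ⟨p, hp⟩ := (le_iff_exists_add hS m s).1 fun j => (hm j).trans_le inf_le_left
  obtain ⟨q, hq⟩ := (le_iff_exists_add hS m t).1 fun j => (hm j).trans_le inf_le_right
  refine ⟨m, p, q, hp.trans (add_comm _ _), hq.trans (add_comm _ _), fun j => ?_⟩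
  have h1 : (s : Ω →₀ ℝ≥0) j = (p : Ω →₀ ℝ≥0) j + (m : Ω →₀ ℝ≥0) j := by rw [hp]; rfl
  have h2 : (t : Ω →₀ ℝ≥0) j = (q : Ω →₀ ℝ≥0) j + (m : Ω →₀ ℝ≥0) j := by rw [hq]; rfl
  have h3 := hm j
  rcases le_total ((s : Ω →₀ ℝ≥0) j) ((t : Ω →₀ ℝ≥0) j) with h | h
  · rw [inf_eq_left.2 h] at h3
    left
    simpa [h3] using h1
  · rw [inf_eq_right.2 h] at h3
    right
    simpa [h3] using h2

/-- The witness is `p - q`. Regularity, stated through `s_+` and `s_-`, thereby becomes a statement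
about arbitrary pairs of disjoint support. -/
lemma exists_pos_neg_eq (hS : ∀ i, IsCommensurable (S i)) {p q : sumSemigroup S}
    (h : DisjSupp p q) :
    ∃ (s : Ω → ℝ) (hs : s ∈ differences S), pos hS s hs = p ∧ neg hS s hs = q := by
  have hmem : ∀ r : sumSemigroup S, (fun j => ((r : Ω →₀ ℝ≥0) j : ℝ)) ∈ differences S :=
    fun r => AddSubgroup.subset_closure ⟨r, rfl⟩
  refine ⟨_, (differences S).sub_mem (hmem p) (hmem q), ?_, ?_⟩
  · refine Subtype.ext (Finsupp.ext fun j => ?_)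
    change Real.toNNReal (((p : Ω →₀ ℝ≥0) j : ℝ) - ((q : Ω →₀ ℝ≥0) j : ℝ)) = _
    rcases h j with h | h <;> simp [h]
  · refine Subtype.ext (Finsupp.ext fun j => ?_)
    change Real.toNNReal (-(((p : Ω →₀ ℝ≥0) j : ℝ) - ((q : Ω →₀ ℝ≥0) j : ℝ))) = _
    rcases h j with h | h <;> simp [h]

lemma disjSupp_neg_pos (hS : ∀ i, IsCommensurable (S i)) (s : Ω → ℝ) (hs : s ∈ differences S) :
    DisjSupp (neg hS s hs) (pos hS s hs) := by
  intro j
  change Real.toNNReal (-(s j)) = 0 ∨ Real.toNNReal (s j) = 0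
  rcases le_total 0 (s j) with h | h
  · left; simpa using h
  · right; simpa using h

lemma DisjSupp.zero_right (p : sumSemigroup S) : DisjSupp p 0 := fun _ => Or.inr rfl

end Indices

/-! ### Inner products of the vectors `V̂_s (δ_s · (x ⊗ h))` -/

section DilationVectors

open Correspondence ProductSystem

variable {Ω : Type uΩ} {S : Ω → AddSubmonoid ℝ≥0} (hS : ∀ i, IsCommensurable (S i))
  {A : Type uA} [NonUnitalCStarAlgebra A] [PartialOrder A] [StarOrderedRing A]
  {X : sumSemigroup S → Type uX} [∀ s, NormedAddCommGroup (X s)]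
  [∀ s, NormedSpace ℂ (X s)] [∀ s, Correspondence A (X s)] [ProductSystem A X]
  {H : Type uH} [NormedAddCommGroup H] [InnerProductSpace ℂ H] [CompleteSpace H]
  {K : Type uK} [NormedAddCommGroup K] [InnerProductSpace ℂ K] [CompleteSpace K]

/-- The common isometry `V m` drops out of the inner product, and what remains is the regularity
condition for the disjoint pair `p`, `q`. -/
lemma inner_isometricSemigroup {L : Type*} [NormedAddCommGroup L] [InnerProductSpace ℂ L]
    [CompleteSpace L] {T : sumSemigroup S → L →L[ℂ] L} {J : L →ₗᵢ[ℂ] K}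
    {V : sumSemigroup S → K →L[ℂ] K} (hV : IsIsometricSemigroup V)
    (hT : IsRegularDilation hS T J V) (m : sumSemigroup S) {p q : sumSemigroup S}
    (hpq : DisjSupp p q) (z w : L) :
    ⟪V (m + p) (J z), V (m + q) (J w)⟫_ℂ = ⟪T p z, T q w⟫_ℂ := by
  obtain ⟨s, hs, rfl, rfl⟩ := exists_pos_neg_eq hS hpq
  have h1 := DFunLike.congr_fun (hT s hs) z
  simp only [ContinuousLinearMap.comp_apply] at h1
  let W : K →ₗᵢ[ℂ] K :=
    { toLinearMap := (V m).toLinearMap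
      norm_map' := fun k => by simpa using (hV.isometry m).norm_map_of_map_zero (map_zero _) k }
  have hW : ∀ k, V m k = W k := fun _ => rfl
  rw [hV.map_add, hV.map_add, ContinuousLinearMap.comp_apply, ContinuousLinearMap.comp_apply,
    hW, hW, LinearIsometry.inner_map_map, ← ContinuousLinearMap.adjoint_inner_left (T _), ← h1,
    ContinuousLinearMap.adjoint_inner_left, ContinuousLinearMap.adjoint_inner_left]
  rfl

/-- The vectors `V̂_s (δ_s · (x ⊗ h))` and `δ_0 · h` in the space of a dilation of `T̂`. -/
def dilVec (π : Representation A X H) (J : π.HatSpace →ₗᵢ[ℂ] K) (V : sumSemigroup S → K →L[ℂ] K)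
    (o : Option (Σ s, X s)) (h : H) : K :=
  V (deg o) (J (π.hatVec o h))

variable {hS} {π : Representation A X H} {J : π.HatSpace →ₗᵢ[ℂ] K}
  {V : sumSemigroup S → K →L[ℂ] K}

lemma exists_dilVec_eq (s : sumSemigroup S) (h : H) :
    ∃ F : X s →L[ℂ] K, ∀ y, dilVec π J V (some ⟨s, y⟩) h = F y :=
  ⟨V s ∘L J.toContinuousLinearMap ∘L π.hatVecCLM s h, fun _ => rfl⟩

/-- Continuity in the right factor is what the density arguments need. It holds also for `t = 0`,
where multiplication by `x` is the left action. -/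
lemma exists_dilVec_act_eq {t s : sumSemigroup S} (x : X t) (hs : s ≠ 0) (h : H) :
    ∃ F : X s →L[ℂ] K, ∀ y, dilVec π J V (act A ⟨t, x⟩ (some ⟨s, y⟩)) h = F y := by
  obtain ⟨r, F, hF⟩ := exists_totalMul_eq_clm A hs x
  obtain ⟨G, hG⟩ := exists_dilVec_eq (π := π) (J := J) (V := V) r h
  refine ⟨G ∘L F, fun y => ?_⟩
  change dilVec π J V (some (totalMul A ⟨t, x⟩ ⟨s, y⟩)) h = _
  rw [hF, hG]; rfl

lemma inner_dilVec (hV : IsIsometricSemigroup V)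
    (hJ : IsRegularDilation hS π.hat J V) {o o' : Option (Σ s, X s)}
    (hd : DisjSupp (deg o) (deg o')) (h h' : H) :
    ⟪dilVec π J V o h, dilVec π J V o' h'⟫_ℂ = ⟪π.val o h, π.val o' h'⟫_ℂ := by
  have := inner_isometricSemigroup hS hV hJ 0 hd (π.hatVec o h) (π.hatVec o' h')
  rw [zero_add, zero_add, π.hat_hatVec, π.hat_hatVec, LinearIsometry.inner_map_map] at this
  exact this

/-- The Gram formula of the family: `V_m` cancels, `T̂` absorbs `o` and `o'` into `H`, and the inner
product of `X(m) ⊗ H` remains. -/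
lemma inner_dilVec_act (hV : IsIsometricSemigroup V)
    (hJ : IsRegularDilation hS π.hat J V) {m : sumSemigroup S} (y y' : X m)
    {o o' : Option (Σ s, X s)}
    (hd : DisjSupp (deg o) (deg o')) (h h' : H) :
    ⟪dilVec π J V (act A ⟨m, y⟩ o) h, dilVec π J V (act A ⟨m, y'⟩ o') h'⟫_ℂ =
      ⟪π.val o h, π.σ (ip y y') (π.val o' h')⟫_ℂ := by
  -- The summand of index `0` is `H` rather than a tensor product. Here `y`, `y'` come from `a, b ∈
  -- A`, the degrees stay disjoint, and the claim is `σ(a)* σ(b) = σ(a* b)`.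
  by_cases hm : m = 0
  · subst hm
    obtain ⟨a, rfl⟩ := (unit (A := A) (X := X)).surjective y
    obtain ⟨b, rfl⟩ := (unit (A := A) (X := X)).surjective y'
    rw [inner_dilVec hV hJ (by simpa [deg_act] using hd), ip_unit]
    have h1 := π.val_act_totalUnit a o
    have h2 := π.val_act_totalUnit b o'
    rw [totalUnit] at h1 h2
    rw [h1, h2, map_mul, map_star, ContinuousLinearMap.star_eq_adjoint, mul_apply_eq_comp,
      ContinuousLinearMap.adjoint_inner_right]
    rfl
  · rw [dilVec, dilVec, deg_act, deg_act, inner_isometricSemigroup hS hV hJ m hd,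
      π.hat_hatVec_act hm, π.hat_hatVec_act hm, LinearIsometry.inner_map_map, inner_tmul_tmul]

/-- By the Gram formula both sides depend on the left factors only through their inner products, and
`⟨x y, x' y'⟩ = ⟨y, ⟨x, x'⟩ y'⟩`. -/
lemma inner_dilVec_act_act (hV : IsIsometricSemigroup V)
    (hJ : IsRegularDilation hS π.hat J V) {t m : sumSemigroup S} (hm : m ≠ 0) (x x' : X t)
    (y y' : X m)
    {o o' : Option (Σ s, X s)} (hd : DisjSupp (deg o) (deg o')) (h h' : H) :
    ⟪dilVec π J V (act A ⟨t, x⟩ (act A ⟨m, y⟩ o)) h,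
      dilVec π J V (act A ⟨t, x'⟩ (act A ⟨m, y'⟩ o')) h'⟫_ℂ =
      ⟪dilVec π J V (act A ⟨m, y⟩ o) h,
        dilVec π J V (act A (totalUnit X (ip (A := A) x x')) (act A ⟨m, y'⟩ o')) h'⟫_ℂ := by
  obtain ⟨r, z, z', hz, hz', hzz⟩ := exists_totalMul_eq (A := A) hm x x' y y'
  rw [act_act, act_act, act_act, hz, hz', totalUnit_mul, inner_dilVec_act hV hJ _ _ hd,
    inner_dilVec_act hV hJ _ _ hd, hzz]

lemma isCovariantFamily_dilVec (hV : IsIsometricSemigroup V)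
    (hJ : IsRegularDilation hS π.hat J V) : IsCovariantFamily A (dilVec π J V) where
  map_add {s} x y h := by
    obtain ⟨F, hF⟩ := exists_dilVec_eq (π := π) (J := J) (V := V) s h
    rw [hF, hF, hF, map_add]
  map_smul {s} c x h := by
    obtain ⟨F, hF⟩ := exists_dilVec_eq (π := π) (J := J) (V := V) s h
    rw [hF, hF, map_smul]
  inner_act {t} x x' o o' h h' := by
    obtain ⟨m, p, q, hp, hq, hd⟩ := exists_add_disjSupp hS (deg o) (deg o')
    by_cases hm : m = 0
    · subst hm
      rw [zero_add] at hp hq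
      subst hp hq
      -- The degrees of `o`, `o'` are already disjoint, so `x`, `x'` themselves play the role of the
      -- common left factor in the Gram formula.
      rw [inner_dilVec_act hV hJ _ _ hd, inner_dilVec hV hJ, π.val_act_totalUnit]
      · rfl
      · simpa [deg_act, totalUnit] using hd
    · -- by density the second index, and then the first one, may be taken to be a product
      have key : ∀ (y : X m) (o : Option (Σ s, X s)), deg o = p →
          ⟪dilVec π J V (act A ⟨t, x⟩ (act A ⟨m, y⟩ o)) h, dilVec π J V (act A ⟨t, x'⟩ o') h'⟫_ℂ =
          ⟪dilVec π J V (act A ⟨m, y⟩ o) h,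
            dilVec π J V (act A (totalUnit X (ip (A := A) x x')) o') h'⟫_ℂ := by
        intro y o ho
        refine eq_of_eq_on_act (A := A) hm
          (f := fun o' => ⟪dilVec π J V (act A ⟨t, x⟩ (act A ⟨m, y⟩ o)) h,
            dilVec π J V (act A ⟨t, x'⟩ o') h'⟫_ℂ)
          (g := fun o' => ⟪dilVec π J V (act A ⟨m, y⟩ o) h,
            dilVec π J V (act A (totalUnit X (ip (A := A) x x')) o') h'⟫_ℂ)
          (fun s hs => ?_) (fun s hs => ?_) (fun y' o' ho' => ?_)
          (Representation.add_ne_zero_of_left hm) o' hq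
        · obtain ⟨F, hF⟩ := exists_dilVec_act_eq (π := π) (J := J) (V := V) x' hs h'
          exact ⟨innerSL ℂ _ ∘L F, fun y => congrArg (inner ℂ _) (hF y)⟩
        · obtain ⟨F, hF⟩ := exists_dilVec_act_eq (π := π) (J := J) (V := V)
            (totalUnit X (ip (A := A) x x')).2 hs h'
          exact ⟨innerSL ℂ _ ∘L F, fun y => congrArg (inner ℂ _) (hF y)⟩
        · exact inner_dilVec_act_act hV hJ hm x x' y y' (by rwa [ho, ho']) h h'
      -- The inner product is conjugate linear in the first variable, so both sides are conjugated
      -- before the density argument is applied to `o`.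
      have key' := eq_of_eq_on_act (A := A) hm
          (f := fun o => ⟪dilVec π J V (act A ⟨t, x'⟩ o') h', dilVec π J V (act A ⟨t, x⟩ o) h⟫_ℂ)
          (g := fun o => ⟪dilVec π J V (act A (totalUnit X (ip (A := A) x x')) o') h',
            dilVec π J V o h⟫_ℂ)
          (fun s hs => ?_) (fun s hs => ?_) (fun y o ho => ?_)
          (Representation.add_ne_zero_of_left hm) o hp
      · rw [← inner_conj_symm, key', inner_conj_symm]
      · obtain ⟨F, hF⟩ := exists_dilVec_act_eq (π := π) (J := J) (V := V) x hs h
        exact ⟨innerSL ℂ _ ∘L F, fun y => congrArg (inner ℂ _) (hF y)⟩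
      · obtain ⟨F, hF⟩ := exists_dilVec_eq (π := π) (J := J) (V := V) s h
        exact ⟨innerSL ℂ _ ∘L F, fun y => congrArg (inner ℂ _) (hF y)⟩
      · rw [← inner_conj_symm, key y o ho, inner_conj_symm]

end DilationVectors

/-! ### Density and extensionality on spanning vectors -/

section DenseSpans

lemma mem_of_dense_span {M N : Type*} [NormedAddCommGroup M] [NormedSpace ℂ M]
    [NormedAddCommGroup N] [NormedSpace ℂ N] {s : Set M} (hs : Dense (Submodule.span ℂ s : Set M))
    {P : Submodule ℂ N} (hP : IsClosed (P : Set N)) (F : M →L[ℂ] N) (h : ∀ m ∈ s, F m ∈ P) (m : M) :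
    F m ∈ P := by
  have h1 : Submodule.span ℂ s ≤ P.comap F.toLinearMap := Submodule.span_le.2 h
  have h2 : IsClosed (P.comap F.toLinearMap : Set M) := hP.preimage F.continuous
  have h3 := h2.closure_subset_iff.2 h1
  rw [hs.closure_eq] at h3
  exact h3 (Set.mem_univ m)

variable {A : Type uA} [NonUnitalCStarAlgebra A] [PartialOrder A] [StarOrderedRing A]
variable {H : Type uH} [NormedAddCommGroup H] [InnerProductSpace ℂ H] [CompleteSpace H]
variable {σ : A →⋆ₙₐ[ℂ] (H →L[ℂ] H)}
variable {E : Type uE} [NormedAddCommGroup E] [NormedSpace ℂ E] [Correspondence A E]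

lemma clm_ext_tmul {L : Type*} [NormedAddCommGroup L] [NormedSpace ℂ L]
    {F G : InteriorTensor σ E →L[ℂ] L} (h : ∀ x g, F (tmul σ x g) = G (tmul σ x g)) : F = G := by
  refine DFunLike.coe_injective
    ((denseRange_toInterior σ).equalizer F.continuous G.continuous (funext fun u => ?_))
  change F (toInterior σ E u) = G (toInterior σ E u)
  induction u with
  | zero => simp
  | add u w hu hw => rw [map_add, map_add, map_add, hu, hw]
  | tmul x g => exact h x g

lemma eq_of_inner_tmul {ξ η : InteriorTensor σ E}
    (h : ∀ x g, ⟪ξ, tmul σ x g⟫_ℂ = ⟪η, tmul σ x g⟫_ℂ) : ξ = η :=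
  ext_inner_right ℂ (DFunLike.congr_fun (clm_ext_tmul (F := innerSL ℂ ξ) (G := innerSL ℂ η) h))

variable {S : Type uΩ} [AddCommMonoid S] {X : S → Type uX} [∀ s, NormedAddCommGroup (X s)]
  [∀ s, NormedSpace ℂ (X s)] {I : Type uH} {K : Type uK} [NormedAddCommGroup K]
  [InnerProductSpace ℂ K] {v : Option (Σ s, X s) → I → K}

lemma clm_ext_familyVec {L : Type*} [NormedAddCommGroup L] [NormedSpace ℂ L]
    {F G : familySpan v →L[ℂ] L} (h : ∀ o i, F (familyVec v o i) = G (familyVec v o i)) :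
    F = G := by
  ext k
  refine mem_of_familyVec_mem (M := LinearMap.eqLocus F.toLinearMap G.toLinearMap)
    (isClosed_eq F.continuous G.continuous) h k

lemma dense_of_familyVec_mem {s : Set (familySpan v)}
    (h : ∀ o i, familyVec v o i ∈ (Submodule.span ℂ s).topologicalClosure) :
    Dense (Submodule.span ℂ s : Set (familySpan v)) :=
  fun k => mem_of_familyVec_mem (Submodule.isClosed_topologicalClosure _) h k

end DenseSpans

/-! ### Properties of the minimal dilation -/

section MinimalDilation

open Correspondence ProductSystem

variable {Ω : Type uΩ} {S : Ω → AddSubmonoid ℝ≥0} {hS : ∀ i, IsCommensurable (S i)}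
  {A : Type uA} [NonUnitalCStarAlgebra A] [PartialOrder A] [StarOrderedRing A]
  {X : sumSemigroup S → Type uX} [∀ s, NormedAddCommGroup (X s)]
  [∀ s, NormedSpace ℂ (X s)] [∀ s, Correspondence A (X s)] [ProductSystem A X]
  {H : Type uH} [NormedAddCommGroup H] [InnerProductSpace ℂ H] [CompleteSpace H]
  {K : Type uK} [NormedAddCommGroup K] [InnerProductSpace ℂ K] [CompleteSpace K]
  {π : Representation A X H} {J : π.HatSpace →ₗᵢ[ℂ] K} {V : sumSemigroup S → K →L[ℂ] K}
  (hV : IsIsometricSemigroup V) (hJ : IsRegularDilation hS π.hat J V)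

lemma dilVec_none (hV : IsIsometricSemigroup V) (h : H) : dilVec π J V none h = J (π.inl h) := by
  change V 0 _ = _
  rw [hV.map_zero]; rfl

lemma dilVec_totalUnit (a : A) (h : H) :
    dilVec π J V (some (totalUnit X a)) h = dilVec π J V none (π.σ a h) := by
  change V 0 (J (π.hatVec (some ⟨0, unit (A := A) a⟩) h)) = V 0 (J (π.hatVec none (π.σ a h)))
  rw [π.hatVec_some_zero, π.T_unit]; rfl

/-- The embedding of `H` into the closed span of the vectors `V̂_s (δ_s · (x ⊗ h))`, `δ_0 · h`. -/
def dilIncl (hV : IsIsometricSemigroup V) : H →ₗᵢ[ℂ] familySpan (dilVec π J V) where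
  toLinearMap := (J.comp π.inl).toLinearMap.codRestrict _ fun h => by
    have := (familyVec (dilVec π J V) none h).2
    rwa [coe_familyVec, dilVec_none hV] at this
  norm_map' h := (J.comp π.inl).norm_map h

lemma dilIncl_apply (h : H) : dilIncl hV h = familyVec (dilVec π J V) none h :=
  Subtype.ext (by rw [coe_familyVec, dilVec_none hV]; rfl)

/-- The isometric representation dilating `π`, on the closed span of the vectors
`V̂_s (δ_s · (x ⊗ h))`, `δ_0 · h`. -/
abbrev dilRep : Representation A X (familySpan (dilVec π J V)) :=
  (isCovariantFamily_dilVec hV hJ).rep A (dilVec π J V)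

lemma dilRep_T_dilIncl (s : sumSemigroup S) (x : X s) (h : H) :
    (dilRep hV hJ).T s x (dilIncl hV h) = familyVec (dilVec π J V) (some ⟨s, x⟩) h := by
  rw [dilIncl_apply, IsCovariantFamily.rep_T_familyVec]; rfl

lemma dilRep_σ_dilIncl (a : A) (h : H) :
    (dilRep hV hJ).σ a (dilIncl hV h) = dilIncl hV (π.σ a h) := by
  rw [dilIncl_apply, dilIncl_apply, IsCovariantFamily.rep_σ_familyVec]
  refine Subtype.ext ?_
  rw [coe_familyVec, coe_familyVec]
  exact dilVec_totalUnit a h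

lemma inner_familyVec_dilVec (hV : IsIsometricSemigroup V) (hJ : IsRegularDilation hS π.hat J V)
    {o o' : Option (Σ s, X s)} (hd : DisjSupp (deg o) (deg o')) (h h' : H) :
    ⟪familyVec (dilVec π J V) o h, familyVec (dilVec π J V) o' h'⟫_ℂ =
      ⟪π.val o h, π.val o' h'⟫_ℂ := by
  rw [Submodule.coe_inner, coe_familyVec, coe_familyVec, inner_dilVec hV hJ hd]

lemma dilRep_σ_comp_proj (a : A) :
    (dilRep hV hJ).σ a ∘L proj (dilIncl hV) = (dilIncl hV).toContinuousLinearMap ∘L π.σ a ∘L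
      ((dilIncl hV).toContinuousLinearMap)† := by
  ext1 k
  exact dilRep_σ_dilIncl hV hJ a _

/-- Under the embedding of fibres, `Ṽ_t` sends `x ⊗ h` to the generating vector of `(x, h)`. The
degrees `s_-`, `s_+` have disjoint supports, so the inner products of these vectors are those of
`T(x) h` and `T(y) g`. -/
lemma isRegularDilationRep_dilRep : IsRegularDilationRep hS π (dilIncl hV) (dilRep hV hJ) := by
  intro s hs
  have hW : ∀ a, (dilIncl hV).toContinuousLinearMap ∘L π.σ a =
      (dilRep hV hJ).σ a ∘L (dilIncl hV).toContinuousLinearMap := fun a =>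
    ContinuousLinearMap.ext fun h => (dilRep_σ_dilIncl hV hJ a h).symm
  have h1 : ∀ (t : sumSemigroup S) (x : X t) (h : H),
      (dilRep hV hJ).tilde t (fibreIncl π (dilRep hV hJ) (dilIncl hV) t (tmul π.σ x h)) =
        familyVec (dilVec π J V) (some ⟨t, x⟩) h := by
    intro t x h
    rw [fibreIncl, tensorMap_tmul π.σ _ hW, Representation.tilde_tmul]
    exact dilRep_T_dilIncl hV hJ t x h
  refine clm_ext_tmul fun x h => eq_of_inner_tmul fun y g => ?_
  simp only [ContinuousLinearMap.comp_apply, ContinuousLinearMap.adjoint_inner_left]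
  rw [h1, h1, Representation.tilde_tmul, Representation.tilde_tmul,
    inner_familyVec_dilVec hV hJ]
  · rfl
  · exact fun j => (disjSupp_neg_pos hS s hs j).symm

lemma dense_span_dilRep : Dense (Submodule.span ℂ (Set.range (dilIncl hV) ∪
    {k | ∃ s, ∃ (x : X s) (h : H), k = (dilRep hV hJ).T s x (dilIncl hV h)}) :
      Set (familySpan (dilVec π J V))) := by
  refine dense_of_familyVec_mem fun o h => Submodule.le_topologicalClosure _
    (Submodule.subset_span ?_)
  obtain _ | ⟨s, x⟩ := o
  · exact Or.inl ⟨h, dilIncl_apply hV h⟩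
  · exact Or.inr ⟨s, x, h, (dilRep_T_dilIncl hV hJ s x h).symm⟩

lemma dense_span_dilRep_of_isNondegenerate (hσ : IsNondegenerate π.σ) :
    Dense (Submodule.span ℂ {k | ∃ s, ∃ (x : X s) (h : H),
      k = (dilRep hV hJ).T s x (dilIncl hV h)} : Set (familySpan (dilVec π J V))) := by
  refine dense_of_familyVec_mem fun o h => ?_
  obtain _ | ⟨s, x⟩ := o
  -- Only the vectors of `H` remain to be reached. They are limits of sums of `σ(a) g`, and `σ(a) g
  -- = V_0(a) g` on `H`.
  · rw [← dilIncl_apply hV]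
    refine mem_of_dense_span hσ (Submodule.isClosed_topologicalClosure _)
      (dilIncl hV).toContinuousLinearMap ?_ h
    rintro _ ⟨a, g, rfl⟩
    refine Submodule.le_topologicalClosure _ (Submodule.subset_span ⟨0, unit (A := A) a, g, ?_⟩)
    rw [Representation.T_unit, dilRep_σ_dilIncl]; rfl
  · exact Submodule.le_topologicalClosure _ (Submodule.subset_span
      ⟨s, x, h, (dilRep_T_dilIncl hV hJ s x h).symm⟩)

/-- Degree `0` is disjoint from every degree, so the adjoint of the embedding maps the generating
vector of `(o, h)` to `π.val o h`. Left multiplication by `x` then corresponds to `T_s(x)`; thus `V`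
coextends `T`. -/
lemma adjoint_dilIncl_dilRep_T (s : sumSemigroup S) (x : X s) :
    ((dilIncl hV).toContinuousLinearMap)† ∘L (dilRep hV hJ).T s x =
      π.T s x ∘L ((dilIncl hV).toContinuousLinearMap)† := by
  have h1 : ∀ o h, (((dilIncl hV).toContinuousLinearMap)†) (familyVec (dilVec π J V) o h) =
      π.val o h := by
    intro o h
    refine ext_inner_right ℂ fun g => ?_
    rw [ContinuousLinearMap.adjoint_inner_left]
    change ⟪_, dilIncl hV g⟫_ℂ = _
    rw [dilIncl_apply, inner_familyVec_dilVec hV hJ (DisjSupp.zero_right _)]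
    rfl
  refine clm_ext_familyVec fun o h => ?_
  rw [ContinuousLinearMap.comp_apply, ContinuousLinearMap.comp_apply,
    IsCovariantFamily.rep_T_familyVec, h1, h1, π.val_act]
  rfl

/-- The coextension property in degree `0` gives `P_H V_0(a) = j σ(a) j*`, which is also `V_0(a)
P_H`. -/
lemma proj_comp_dilRep_σ (a : A) :
    proj (dilIncl hV) ∘L (dilRep hV hJ).σ a = (dilRep hV hJ).σ a ∘L proj (dilIncl hV) := by
  have h := adjoint_dilIncl_dilRep_T hV hJ 0 (unit (A := A) a)
  rw [Representation.T_unit, Representation.T_unit] at h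
  rw [dilRep_σ_comp_proj, proj, ContinuousLinearMap.comp_assoc, h]

lemma proj_dilRep_T_eq_zero (s : sumSemigroup S) (x : X s) {k : familySpan (dilVec π J V)}
    (hk : k ∈ (LinearMap.range (dilIncl hV).toLinearMap)ᗮ) :
    proj (dilIncl hV) ((dilRep hV hJ).T s x k) = 0 := by
  have h1 : (((dilIncl hV).toContinuousLinearMap)†) k = 0 := by
    refine ext_inner_left ℂ fun g => ?_
    rw [ContinuousLinearMap.adjoint_inner_right, inner_zero_right]
    exact (Submodule.mem_orthogonal _ k).1 hk _ ⟨g, rfl⟩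
  have h2 := DFunLike.congr_fun (adjoint_dilIncl_dilRep_T hV hJ s x) k
  rw [ContinuousLinearMap.comp_apply, ContinuousLinearMap.comp_apply, h1, map_zero] at h2
  rw [proj, ContinuousLinearMap.comp_apply, h2, map_zero]

/-- Vectors of `H` are approximated through `σ`. The vectors `V_s(x) h` are approximated through the
left action on `X(s)`, using `V_s(a y) h = V_0(a) V_s(y) h`. -/
lemma isNondegenerate_dilRep (hσ : IsNondegenerate π.σ) (hX : IsEssential A X) :
    IsNondegenerate (dilRep hV hJ).σ := by
  refine dense_of_familyVec_mem fun o h => ?_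
  obtain _ | ⟨s, x⟩ := o
  · rw [← dilIncl_apply hV]
    refine mem_of_dense_span hσ (Submodule.isClosed_topologicalClosure _)
      (dilIncl hV).toContinuousLinearMap ?_ h
    rintro _ ⟨a, g, rfl⟩
    exact Submodule.le_topologicalClosure _ (Submodule.subset_span
      ⟨a, dilIncl hV g, (dilRep_σ_dilIncl hV hJ a g).symm⟩)
  · rw [← dilRep_T_dilIncl hV hJ]
    -- Continuity of `y ↦ V_s(y) h` transfers density of the span of `A X(s)` to these vectors.
    have hb : ∀ y : X s, ‖(dilRep hV hJ).T s y (dilIncl hV h)‖ ≤ ‖dilIncl (J := J) hV h‖ * ‖y‖ :=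
      fun y => (norm_le_of_cc ((dilRep hV hJ).completelyContractive s) y _).trans_eq (mul_comm _ _)
    let F : X s →L[ℂ] familySpan (dilVec π J V) :=
      LinearMap.mkContinuous
        { toFun y := (dilRep hV hJ).T s y (dilIncl hV h)
          map_add' y z := by rw [map_add]; rfl
          map_smul' c y := by rw [map_smul]; rfl } _ hb
    refine mem_of_dense_span (hX s) (Submodule.isClosed_topologicalClosure _) F ?_ x
    rintro _ ⟨a, y, rfl⟩
    exact Submodule.le_topologicalClosure _ (Submodule.subset_span
      ⟨a, (dilRep hV hJ).T s y (dilIncl hV h), DFunLike.congr_fun ((dilRep hV hJ).T_lact s a y) _⟩)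

end MinimalDilation

end ProductSystemDilation

end

open ProductSystemDilation in
theorem proposition3p2
    {Ω : Type uΩ} (S : Ω → AddSubmonoid ℝ≥0) (hS : ∀ i, IsCommensurable (S i))
    {A : Type uA} [NonUnitalCStarAlgebra A] [PartialOrder A] [StarOrderedRing A]
    (X : sumSemigroup S → Type uX) [∀ s, NormedAddCommGroup (X s)] [∀ s, NormedSpace ℂ (X s)]
    [∀ s, CompleteSpace (X s)] [∀ s, Correspondence A (X s)] [ProductSystem A X]
    {H : Type uH} [NormedAddCommGroup H] [InnerProductSpace ℂ H] [CompleteSpace H]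
    (π : Representation A X H)
    (hdil : HasRegularIsometricDilation.{max uΩ uX uH, uK, uΩ} hS π.hat) :
    ∃ (K : Type uK) (_ : NormedAddCommGroup K) (_ : InnerProductSpace ℂ K) (_ : CompleteSpace K)
      (j : H →ₗᵢ[ℂ] K) (V : Representation A X K),
      V.IsIsometric ∧
      -- `H` reduces `V_0(A)`, and `V_0(a) P_H = σ(a) P_H`
      (∀ a : A, proj j ∘L V.σ a = V.σ a ∘L proj j ∧
        V.σ a ∘L proj j = j.toContinuousLinearMap ∘L π.σ a ∘L (j.toContinuousLinearMap)†) ∧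
      -- `V` is a regular dilation
      IsRegularDilationRep hS π j V ∧
      -- minimality; the second form is the one for nondegenerate `σ`
      Dense (Submodule.span ℂ (Set.range j ∪ {k : K | ∃ s, ∃ (x : X s) (h : H),
        k = V.T s x (j h)}) : Set K) ∧
      (IsNondegenerate π.σ → Dense (Submodule.span ℂ {k : K | ∃ s, ∃ (x : X s) (h : H),
        k = V.T s x (j h)} : Set K)) ∧
      -- `P_H V_s(x)` vanishes on `K ⊖ H`
      (∀ s (x : X s), ∀ k ∈ (LinearMap.range j.toLinearMap)ᗮ, proj j (V.T s x k) = 0) ∧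
      -- nondegeneracy of `V_0`
      (IsNondegenerate π.σ → IsEssential A X → IsNondegenerate V.σ) := by 
  obtain ⟨K, _, _, _, J, V, hV, hJ⟩ := hdil
  -- The new space is a closed subspace of the given dilation space, hence complete and in the same
  -- universe.
  exact ⟨familySpan (dilVec π J V), inferInstance, inferInstance, inferInstance, dilIncl hV,
    dilRep hV hJ, (isCovariantFamily_dilVec hV hJ).rep_isIsometric,
    fun a => ⟨proj_comp_dilRep_σ hV hJ a, dilRep_σ_comp_proj hV hJ a⟩,
    isRegularDilationRep_dilRep hV hJ, dense_span_dilRep hV hJ,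
    dense_span_dilRep_of_isNondegenerate hV hJ, fun s x _ hk => proj_dilRep_T_eq_zero hV hJ s x hk,
    isNondegenerate_dilRep hV hJ⟩
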